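/- Let $b(x)=x$ (case XXX) or $b(x)=\sinh(x)$ (case XXZ), and put $\mathcal L:=\mathbb R$ in case XXX and $\mathcal L:=\mathbb R+\pi\sqrt{-1}\,\mathbb Z$ in case XXZ. For $a\in\mathbb C$ write $b(x)^a:=e^{a\,\mathrm{Log}(b(x))}$ with $\mathrm{Log}$ the principal logarithm, and write $u(x\pm y):=u(x+y)u(x-y)$ for a function $u$ of one variable. Let $M,N\ge 0$ be integers. Let $(\mathbf e_+,\mathbf e_-)$ be the standard basis of $\mathbb C^2$, let $\Omega:=\mathbf e_+^{\otimes N}\in(\mathbb C^2)^{\otimes N}$, and let a subscript $r$ (resp. $rs$) on an operator on $\mathbb C^2$ (resp. $\mathbb C^2\otimes\mathbb C^2$) mean that it acts on the $r$-th tensor leg (resp. on the $r$-th and $s$-th legs, in that order) of $(\mathbb C^2)^{\otimes N}$. Put $\sigma^z=\left(\begin{smallmatrix}1&0\\0&-1\end{smallmatrix}\right)$, $\sigma^-=\left(\begin{smallmatrix}0&0\\1&0\end{smallmatrix}\right)$, $\check\sigma=\left(\begin{smallmatrix}0&0\\0&1\end{smallmatrix}\right)$, and, with respect to the ordered basis $(\mathbf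 e_+\otimes\mathbf e_+,\mathbf e_+\otimes\mathbf e_-,\mathbf e_-\otimes\mathbf e_+,\mathbf e_-\otimes\mathbf e_-)$, $$r(x)=\begin{pmatrix}0&0&0&0\\0&-\frac{b'(x)}{b(x)}&\frac{b'(0)}{b(x)}&0\\0&\frac{b'(0)}{b(x)}&-\frac{b'(x)}{b(x)}&0\\0&0&0&0\end{pmatrix},\qquad \kappa^{\Delta}(x)=2\Delta\frac{b'(x)}{b(x)}\check\sigma,$$ $$\Theta(x,y)=r(x-y)+(\sigma^z\otimes1)\,r(x+y)\,(\sigma^z\otimes1),\qquad a_r^\Delta(\mathbf t)=-\kappa_r^\Delta(t_r)+\sum_{s\ne r}\Theta_{rs}(t_r,t_s).$$ For $\mathbf x\in\mathbb C^M$ and $\mathbf t\in\mathbb C^N$ put $$\beta(x;\mathbf t)=2b'(x)\sum_{r=1}^N\frac{b(t_r)}{b(x\pm t_r)}\sigma_r^-,\qquad \beta^{(M)}(\mathbf x;\mathbf t)=\prod_{i=1}^M\beta(x_i;\mathbf t)$$ (a product of commuting operators, equal to $1$ if $M=0$), and, for $k\in\mathbb C^\times$ and $\Delta\in\mathbb C$,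 $$w_{\mathrm{cl}}^{(M)}(\mathbf x;\mathbf t;\Delta)=\Bigl(\prod_{i=1}^M b(x_i)\,g(x_i)\Bigr)\prod_{1\le i<j\le M}h(x_i\pm x_j)\prod_{i=1}^M\prod_{r=1}^N F(t_r\pm x_i),$$ where $g(x)=b(x)^{\frac2k(1-\Delta)-1}$, $h(x)=b(x)^{\frac2k}$ and $F(x)=b(x)^{-\frac1k}$. **Theorem.** Let $k\in\mathbb C^\times$ and $\Delta\in\mathbb C$ with $\Re(k)\le0$ and $\Re((1-\Delta-N)/k)<\frac12$. Let $\mathbf x_0\in\mathbb C^M$ be such that $x_{0,i}\notin\mathcal L$ for all $i$ and $x_{0,i}\pm x_{0,j}\notin\mathcal L$ (both signs) for all $i\ne j$. Then for every $\mathbf t$ in $$D:=\{\mathbf t\in\mathbb C^N\mid t_r\notin\pm x_{0,i}+\mathcal L\ \text{ for all } r,i\}$$ the integral $$f_{M,\mathrm{cl}}(\mathbf t):=\int_{\mathbf x_0+\mathbb R^M}w_{\mathrm{cl}}^{(M)}(\mathbf x;\mathbf t;\Delta)\,\beta^{(M)}(\mathbf x;\mathbf t)\Omega\,d^M\mathbf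 x$$ converges absolutely, $f_{M,\mathrm{cl}}$ is an analytic $(\mathbb C^2)^{\otimes N}$-valued function on $D$, and it satisfies the classical boundary KZ equations $$k\,(\partial_{t_r}f_{M,\mathrm{cl}})(\mathbf t)=a_r^\Delta(\mathbf t)f_{M,\mathrm{cl}}(\mathbf t),\qquad r=1,\dots,N,$$ where the $r$-th equation holds at every $\mathbf t\in D$ away from the poles of the coefficients, that is, whenever $b(t_r)\ne0$ and $b(t_r-t_s)\ne0\ne b(t_r+t_s)$ for all $s\ne r$. -/

import Mathlib

noncomputable section

namespace BoundaryKZ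

/-- The two spin chains: rational (XXX) and trigonometric (XXZ). -/
inductive Chain
  | xxx
  | xxz

/-- The function `b`: `b(x) = x` for XXX and `b(x) = sinh x` for XXZ. -/
def b : Chain → ℂ → ℂ
  | .xxx => fun x => x
  | .xxz => fun x => Complex.sinh x

/-- The derivative `b'` of `b`. -/
def b' (c : Chain) (x : ℂ) : ℂ := deriv (b c) x

/-- The set `𝓛`: the real line for XXX, and `ℝ + π √-1 ℤ` for XXZ. -/
def cutLines : Chain → Set ℂ
  | .xxx => {z | ∃ y : ℝ, z = y}
  | .xxz => {z | ∃ (y : ℝ) (n : ℤ), z = y + Real.pi * Complex.I * n}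

/-- The branch `b(x)^a = exp (Log (b x) * a)`, with `Log` the principal logarithm. -/
def bpow (c : Chain) (a x : ℂ) : ℂ := Complex.exp (Complex.log (b c x) * a)

/-- The space `(ℂ²)^{⊗N}`, in coordinates with respect to the tensor product basis
`e_{σ 0} ⊗ ⋯ ⊗ e_{σ (N-1)}`; the index `0 : Fin 2` stands for `e₊` and `1 : Fin 2` for `e₋`. -/
abbrev V (N : ℕ) : Type := (Fin N → Fin 2) → ℂ

/-- Linear operators on `(ℂ²)^{⊗N}`, as matrices with respect to the tensor product basis. -/
abbrev Op (N : ℕ) : Type := Matrix (Fin N → Fin 2) (Fin N → Fin 2) ℂ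

/-- `A_r`: the operator `A` on `ℂ²` acting on the `r`-th tensor leg. -/
def leg {N : ℕ} (r : Fin N) (A : Matrix (Fin 2) (Fin 2) ℂ) : Op N :=
  fun σ τ => if ∀ q, q ≠ r → σ q = τ q then A (σ r) (τ r) else 0

/-- `B_{rs}`, for `r ≠ s`: the operator `B` on `ℂ² ⊗ ℂ²` acting on the tensor legs `r` and `s`,
its first factor on leg `r` and its second factor on leg `s`. -/
def legs {N : ℕ} (r s : Fin N) (B : Matrix (Fin 2 × Fin 2) (Fin 2 × Fin 2) ℂ) : Op N :=
  fun σ τ => if ∀ q, q ≠ r → q ≠ s → σ q = τ q then B (σ r, σ s) (τ r, τ s) else 0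

/-- The pseudo-vacuum vector `Ω = e₊ ⊗ ⋯ ⊗ e₊`. -/
def Omega (N : ℕ) : V N := Pi.single (fun _ => 0) 1

def sigmaZ : Matrix (Fin 2) (Fin 2) ℂ := !![1, 0; 0, -1]

def sigmaMinus : Matrix (Fin 2) (Fin 2) ℂ := !![0, 0; 1, 0]

def sigmaCheck : Matrix (Fin 2) (Fin 2) ℂ := !![0, 0; 0, 1]

/-- The classical `r`-matrix on `ℂ² ⊗ ℂ²`; the `4 × 4` matrix is with respect to the ordered basis
`e₊ ⊗ e₊, e₊ ⊗ e₋, e₋ ⊗ e₊, e₋ ⊗ e₋`. -/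
def rMat (c : Chain) (x : ℂ) : Matrix (Fin 2 × Fin 2) (Fin 2 × Fin 2) ℂ :=
  Matrix.submatrix
    (!![0, 0, 0, 0;
        0, -(b' c x / b c x), b' c 0 / b c x, 0;
        0, b' c 0 / b c x, -(b' c x / b c x), 0;
        0, 0, 0, 0] : Matrix (Fin 4) (Fin 4) ℂ)
    (finProdFinEquiv : Fin 2 × Fin 2 ≃ Fin (2 * 2))
    (finProdFinEquiv : Fin 2 × Fin 2 ≃ Fin (2 * 2))

/-- The classical `K`-matrix `κ^δ(x)` on `ℂ²`. -/
def kappa (c : Chain) (δ x : ℂ) : Matrix (Fin 2) (Fin 2) ℂ :=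
  (2 * δ * (b' c x / b c x)) • sigmaCheck

/-- `Θ(x,y) = r(x-y) + (σ^z ⊗ 1) r(x+y) (σ^z ⊗ 1)`. -/
def Theta (c : Chain) (x y : ℂ) : Matrix (Fin 2 × Fin 2) (Fin 2 × Fin 2) ℂ :=
  rMat c (x - y) + Matrix.kronecker sigmaZ 1 * rMat c (x + y) * Matrix.kronecker sigmaZ 1

/-- `a_r^Δ(t) = -κ_r^Δ(t_r) + ∑_{s ≠ r} Θ_{rs}(t_r, t_s)`. -/
def aOp (c : Chain) {N : ℕ} (Δ : ℂ) (r : Fin N) (t : Fin N → ℂ) : Op N :=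
  -leg r (kappa c Δ (t r)) + ∑ s ∈ Finset.univ.erase r, legs r s (Theta c (t r) (t s))

/-- `t` lies off the polar set of the meromorphic operator `a_r^Δ`. -/
def OffPoles (c : Chain) {N : ℕ} (r : Fin N) (t : Fin N → ℂ) : Prop :=
  b c (t r) ≠ 0 ∧ ∀ s, s ≠ r → b c (t r - t s) ≠ 0 ∧ b c (t r + t s) ≠ 0

/-- The partial derivative `∂f/∂t_r` at `t`. -/
def partialDeriv {N : ℕ} (r : Fin N) (f : (Fin N → ℂ) → V N) (t : Fin N → ℂ) : V N :=
  deriv (fun z => f (Function.update t r z)) (t r)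

/-- `f` satisfies the boundary KZ equations `k ∂_{t_r} f = a_r^Δ(t) f`, `r = 1, …, N`, on `D`.
The coefficients are meromorphic, and the `r`-th equation is an equation off the poles of `a_r^Δ`. -/
def SolvesKZ (c : Chain) {N : ℕ} (k Δ : ℂ) (f : (Fin N → ℂ) → V N) (D : Set (Fin N → ℂ)) : Prop :=
  ∀ r : Fin N, ∀ t ∈ D, OffPoles c r t → k • partialDeriv r f t = (aOp c Δ r t).mulVec (f t)

/-- `β(x;t) = 2 b'(x) ∑_r b(t_r) / (b(x+t_r) b(x-t_r)) σ_r^-`. -/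
def beta (c : Chain) {N : ℕ} (x : ℂ) (t : Fin N → ℂ) : Op N :=
  (2 * b' c x) • ∑ r, (b c (t r) / (b c (x + t r) * b c (x - t r))) • leg r sigmaMinus

/-- `β^{(M)}(x;t) = β(x_1;t) ⋯ β(x_M;t)`. The factors commute. -/
def betaM (c : Chain) {M N : ℕ} (x : Fin M → ℂ) (t : Fin N → ℂ) : Op N :=
  (List.ofFn fun i => beta c (x i) t).prod

def gcl (c : Chain) (k Δ x : ℂ) : ℂ := bpow c (2 / k * (1 - Δ) - 1) x

def hcl (c : Chain) (k x : ℂ) : ℂ := bpow c (2 / k) x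

def Fcl (c : Chain) (k x : ℂ) : ℂ := bpow c (-(1 / k)) x

/-- `G_{Δ,cl}(x) = (∏_i b(x_i) g(x_i)) ∏_{i<j} h(x_i + x_j) h(x_i - x_j)`. -/
def Gcl (c : Chain) {M : ℕ} (k Δ : ℂ) (x : Fin M → ℂ) : ℂ :=
  (∏ i, b c (x i) * gcl c k Δ (x i)) *
    ∏ i, ∏ j ∈ Finset.Ioi i, hcl c k (x i + x j) * hcl c k (x i - x j)

/-- `w_cl(x;t;Δ) = G_{Δ,cl}(x) ∏_i ∏_r F(t_r + x_i) F(t_r - x_i)`. -/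
def wcl (c : Chain) {M N : ℕ} (k Δ : ℂ) (x : Fin M → ℂ) (t : Fin N → ℂ) : ℂ :=
  Gcl c k Δ x * ∏ i, ∏ r, Fcl c k (t r + x i) * Fcl c k (t r - x i)

/-- The integrand `w_cl(x;t;Δ) β^{(M)}(x;t) Ω`. -/
def integrand (c : Chain) {M N : ℕ} (k Δ : ℂ) (x : Fin M → ℂ) (t : Fin N → ℂ) : V N :=
  wcl c k Δ x t • (betaM c x t).mulVec (Omega N)

/-- The point `x₀ + s` of the shifted real space `x₀ + ℝ^M`. -/
def shift {M : ℕ} (x₀ : Fin M → ℂ) (s : Fin M → ℝ) : Fin M → ℂ := fun i => x₀ i + (s i : ℂ)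

/-- `f_{M,cl}(t)`: the integral of the integrand over `x₀ + ℝ^M` (Lebesgue measure). -/
def fcl (c : Chain) {M N : ℕ} (k Δ : ℂ) (x₀ : Fin M → ℂ) (t : Fin N → ℂ) : V N :=
  ∫ s : Fin M → ℝ, integrand c k Δ (shift x₀ s) t

/-- The set of `t ∈ ℂ^N` with `t_r ∉ ± x₀ᵢ + 𝓛` for all `r`, `i`. -/
def tDomain (c : Chain) {M : ℕ} (N : ℕ) (x₀ : Fin M → ℂ) : Set (Fin N → ℂ) :=
  {t | ∀ r i, t r - x₀ i ∉ cutLines c ∧ t r + x₀ i ∉ cutLines c}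

end BoundaryKZ

end

/-!
The integral `f(t) = ∫ w(x;t) β(x_1;t) ⋯ β(x_M;t) Ω dx` solves the boundary KZ equations because
`k ∂_{t_r}` of the integrand differs from `a_r` times the integrand by a divergence in `x`, which
integrates to zero (`kz_total_derivative`).

Write `ρ = b'/b`, and let `φ(x,t) = 1/b(x-t) - 1/b(x+t)` be the coefficient of `σ^-` in `β` and
`ψ(x,t) = 1/b(x-t) + 1/b(x+t)`. Then `∂φ/∂t = -∂ψ/∂x`. The vector field whose divergence is
needed has the `i`-th component obtained from the integrand by replacing `β(x_i;t)` with
`ψ(x_i,t_r) σ_r^-` (`field`). In `k ∂_{t_r}(integrand) + k ∑_i ∂_{x_i}(field_i)` all derivatives of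
`φ` and `ψ` cancel; only logarithmic derivatives of the weight survive, so `k` disappears and an
algebraic identity for `a_r β(x_1;t) ⋯ β(x_M;t) Ω` remains (`aOp_mulVec_lowered`). It is obtained
by commuting `a_r` through the product: `a_r Ω = 0`, the commutators `[a_r, β(x_i)]` are needed
only on `Ω`, the double commutators `[[a_r, β(x_i)], β(x_j)]` equal `σ_r^-` times a lowering
operator, and there are no further terms (`mulVec_prod_ofFn`). The scalar identities behind
these commutators hold for both chains at once, since they use only the addition formulas of `b`
and `b'`, with `b'^2 = 1 + ε b^2` and `ε ∈ {0, 1}`; by `b(x+y) b(x-y) = b(x)^2 - b(y)^2` they become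
identities between rational functions of squares.

For the analysis, `log |b(z+s)|` equals `log(1+|s|)` (XXX) or `|s|` (XXZ) up to a bounded error,
uniformly for real `s` and for `z` in a compact set off `𝓛`
(`exists_abs_log_norm_b_sub_growth_le`). As `Re k ≤ 0`, the factors `h` are bounded, and the
integrand is dominated by a product of one-variable functions with exponent
`α = 2 Re((1-Δ-N)/k) < 1`, locally uniformly in `t`; these are integrable exactly because `α < 1`.
The field decays like the exponential of `(α-1)` times the growth function in its own variable, so
its flux through the faces of large cubes tends to zero. The individual terms of the divergence
need not be bounded by such products, but the divergence itself is integrable by the total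
derivative identity, and this is all that the divergence theorem on cubes requires. Analyticity in
several variables follows from Osgood's lemma, proved here with Cauchy's formula on a torus.
-/

/-! ### Osgood's lemma -/

open MeasureTheory Complex Metric Function Set in
/-- Cauchy's integral formula on a polydisc, for a continuous function that is holomorphic in each
variable separately. It follows from the formula in one variable by induction on `n`, splitting off
the integral over the first circle. -/
theorem torusIntegral_cauchy_kernel_smul {E : Type*} [NormedAddCommGroup E] [NormedSpace ℂ E]
    [CompleteSpace E] {R : ℝ} (hR : 0 < R) (n : ℕ) (f : (Fin n → ℂ) → E) (c : Fin n → ℂ)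
    (hc : ContinuousOn f (closedBall c R))
    (hd : ∀ z ∈ closedBall c R, ∀ i, DifferentiableAt ℂ (fun u => f (update z i u)) (z i))
    (w : Fin n → ℂ) (hw : w ∈ ball c R) :
    (∯ z in T(c, fun _ => R), (∏ i, (z i - w i)⁻¹) • f z) = (2 * Real.pi * I : ℂ) ^ n • f w := by
  induction n with
  | zero =>
    rw [torusIntegral_dim0]
    simp [Subsingleton.elim c w]
  | succ n ih =>
    have hw' : ∀ i, dist (w i) (c i) < R := (dist_pi_lt_iff hR).1 hw
    have hmem : ∀ x ∈ closedBall (c 0) R, ∀ y ∈ closedBall (c ∘ Fin.succ) R,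
        (Fin.cons x y : Fin (n + 1) → ℂ) ∈ closedBall c R := by
      intro x hx y hy
      refine (dist_pi_le_iff hR.le).2 fun i => ?_
      refine Fin.cases ?_ (fun j => ?_) i
      · simpa using hx
      · simpa using (dist_pi_le_iff hR.le).1 hy j
    have hcons : ∀ x ∈ closedBall (c 0) R,
        ContinuousOn (fun y => f (Fin.cons x y)) (closedBall (c ∘ Fin.succ) R) := by
      intro x hx
      refine hc.comp (Continuous.continuousOn ?_) fun y hy => hmem x hx y hy
      refine continuous_pi fun i => ?_
      refine Fin.cases ?_ (fun j => ?_) i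
      · simpa using continuous_const
      · simpa using continuous_apply j
    have hint : TorusIntegrable (fun z => (∏ i, (z i - w i)⁻¹) • f z) c fun _ => R := by
      have hmap : Continuous (torusMap c fun _ => R) := by
        unfold torusMap; fun_prop
      have hball : ∀ θ, torusMap c (fun _ => R) θ ∈ closedBall c R := by
        intro θ
        refine (dist_pi_le_iff hR.le).2 fun i => ?_
        simp [torusMap, dist_eq_norm, Complex.norm_exp, abs_of_pos hR]
      refine ContinuousOn.integrableOn_compact isCompact_Icc ?_
      refine ContinuousOn.smul (continuousOn_finsetProd _ fun i _ => ?_)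
        (hc.comp hmap.continuousOn fun θ _ => hball θ)
      refine ContinuousOn.inv₀ (by fun_prop) fun θ _ h => ?_
      have h1 : dist (torusMap c (fun _ => R) θ i) (c i) = R := by
        simp [torusMap, dist_eq_norm, Complex.norm_exp, abs_of_pos hR]
      rw [sub_eq_zero.1 h] at h1
      exact (hw' i).ne h1
    rw [torusIntegral_succ hint]
    have hinner : ∀ x ∈ sphere (c 0) R,
        (∯ y in T(c ∘ Fin.succ, (fun _ => R) ∘ Fin.succ),
          (∏ i, ((Fin.cons x y : Fin (n + 1) → ℂ) i - w i)⁻¹) • f (Fin.cons x y)) =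
        (x - w 0)⁻¹ • (2 * Real.pi * I : ℂ) ^ n • f (Fin.cons x (w ∘ Fin.succ)) := by
      intro x hx
      have hx' := sphere_subset_closedBall hx
      simp only [Fin.prod_univ_succ, Fin.cons_zero, Fin.cons_succ, mul_smul]
      rw [torusIntegral_smul]
      congr 1
      refine ih (fun y => f (Fin.cons x y)) (c ∘ Fin.succ) (hcons x hx') ?_ (w ∘ Fin.succ) ?_
      · intro z hz i
        have := hd _ (hmem x hx' z hz) i.succ
        simpa [Fin.cons_update] using this
      · exact (dist_pi_lt_iff hR).2 fun i => hw' i.succ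
    rw [circleIntegral.integral_congr hR.le hinner]
    have hws : w ∘ Fin.succ ∈ closedBall (c ∘ Fin.succ) R :=
      (dist_pi_le_iff hR.le).2 fun i => (hw' i.succ).le
    have hline : ∀ x ∈ closedBall (c 0) R, DifferentiableAt ℂ
        (fun x => (2 * Real.pi * I : ℂ) ^ n • f (Fin.cons x (w ∘ Fin.succ))) x := by
      intro x hx
      have := hd _ (hmem x hx _ hws) 0
      simp only [Fin.update_cons_zero, Fin.cons_zero] at this
      exact this.const_smul _
    have := Complex.circleIntegral_sub_inv_smul_of_differentiable_on_off_countable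
      (s := ∅) countable_empty (hw' 0 : w 0 ∈ ball (c 0) R)
      (fun x hx => (hline x hx).continuousAt.continuousWithinAt)
      (fun x hx => hline x (ball_subset_closedBall hx.1))
    rw [this, smul_smul, pow_succ']
    congr 2
    exact Fin.cons_self_tail w

open MeasureTheory Complex Metric Function Set in
/-- **Osgood's lemma**: a continuous function that is holomorphic in each variable separately is
jointly analytic. By Cauchy's formula on a torus, `f t` is a continuous linear functional of the
function `z ↦ ∏ i, (z i - t i)⁻¹` on the torus, and the latter is an analytic function of `t` with
values in the Banach algebra of continuous functions on the torus. -/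
theorem analyticOnNhd_of_continuousOn_of_differentiableAt_update {E : Type*}
    [NormedAddCommGroup E] [NormedSpace ℂ E] [CompleteSpace E] {n : ℕ} {f : (Fin n → ℂ) → E}
    {D : Set (Fin n → ℂ)} (hD : IsOpen D) (hc : ContinuousOn f D)
    (hd : ∀ z ∈ D, ∀ i, DifferentiableAt ℂ (fun u => f (update z i u)) (z i)) :
    AnalyticOnNhd ℂ f D := by
  intro c hcD
  obtain ⟨R, hR, hRD⟩ := nhds_basis_closedBall.mem_iff.1 (hD.mem_nhds hcD)
  let X := Icc (0 : Fin n → ℝ) fun _ => 2 * Real.pi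
  have : CompactSpace X := isCompact_iff_compactSpace.1 isCompact_Icc
  let μ : Measure X := Measure.comap Subtype.val volume
  have hmap : Continuous (torusMap c fun _ => R) := by
    unfold torusMap; fun_prop
  have hdist : ∀ θ i, dist (torusMap c (fun _ => R) θ i) (c i) = R := by
    intro θ i
    simp [torusMap, dist_eq_norm, Complex.norm_exp, abs_of_pos hR]
  have hball : ∀ θ, torusMap c (fun _ => R) θ ∈ closedBall c R := fun θ =>
    (dist_pi_le_iff hR.le).2 fun i => (hdist θ i).le
  have : IsFiniteMeasure μ := by
    refine ⟨?_⟩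
    rw [Measure.comap_apply _ Subtype.val_injective
      (fun s hs => measurableSet_Icc.subtype_image hs) _ MeasurableSet.univ]
    rw [image_univ, Subtype.range_coe]
    exact measure_Icc_lt_top
  let F : C(X, E) := ⟨fun θ => (∏ i, (R * exp (θ.1 i * I) * I : ℂ)) •
    f (torusMap c (fun _ => R) θ.1), by
      refine Continuous.smul (continuous_finsetProd _ fun i _ => ?_) ?_
      · have hX : Continuous fun θ : X => ((θ.1 i : ℝ) : ℂ) :=
          continuous_ofReal.comp ((continuous_apply i).comp continuous_subtype_val)
        fun_prop
      exact (hc.mono hRD).comp_continuous (by fun_prop) fun θ => hball θ.1⟩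
  have hFint : ∀ h : C(X, ℂ), Integrable (fun θ => h θ • F θ) μ := fun h =>
    (h.continuous.smul F.continuous).integrable_of_hasCompactSupport
      (HasCompactSupport.of_compactSpace _)
  let Λ : C(X, ℂ) →L[ℂ] E := LinearMap.mkContinuous
    { toFun := fun h => ∫ θ, h θ • F θ ∂μ
      map_add' := fun h g => by
        simp only [ContinuousMap.add_apply, add_smul]
        exact integral_add (hFint h) (hFint g)
      map_smul' := fun a h => by
        simp only [ContinuousMap.smul_apply, smul_assoc, RingHom.id_apply]
        exact integral_smul _ _ } (μ.real univ * ‖F‖) (by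
      intro h
      have : ∀ θ, ‖h θ • F θ‖ ≤ ‖h‖ * ‖F‖ := fun θ => by
        rw [norm_smul]
        gcongr
        · exact h.norm_coe_le_norm θ
        · exact F.norm_coe_le_norm θ
      refine (norm_integral_le_of_norm_le_const (Filter.Eventually.of_forall this)).trans ?_
      rw [mul_comm, mul_comm ‖h‖, mul_assoc])
  let coord : Fin n → C(X, ℂ) := fun i => ⟨fun θ => torusMap c (fun _ => R) θ.1 i, by fun_prop⟩
  let K : (Fin n → ℂ) → C(X, ℂ) := fun t =>
    ∏ i, Ring.inverse (coord i - algebraMap ℂ C(X, ℂ) (t i))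
  have hne : ∀ t ∈ ball c R, ∀ i θ, (coord i - algebraMap ℂ C(X, ℂ) (t i)) θ ≠ 0 := by
    intro t ht i θ h
    have h1 : torusMap c (fun _ => R) θ.1 i = t i := by
      simpa [coord, sub_eq_zero, Algebra.algebraMap_eq_smul_one] using h
    have h2 := (dist_pi_lt_iff hR).1 ht i
    rw [← h1, hdist] at h2
    exact lt_irrefl _ h2
  have hunit : ∀ t ∈ ball c R, ∀ i, IsUnit (coord i - algebraMap ℂ C(X, ℂ) (t i)) :=
    fun t ht i => (ContinuousMap.isUnit_iff_forall_ne_zero _).2 (hne t ht i)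
  have hKan : AnalyticAt ℂ K c := by
    refine Finset.analyticAt_fun_prod _ fun i _ => ?_
    have hlin : AnalyticAt ℂ (fun t : Fin n → ℂ => coord i - algebraMap ℂ C(X, ℂ) (t i)) c := by
      refine analyticAt_const.sub ?_
      exact ((Algebra.linearMap ℂ C(X, ℂ)).toContinuousLinearMap.comp
        (ContinuousLinearMap.proj (R := ℂ) (φ := fun _ : Fin n => ℂ) i)).analyticAt c
    obtain ⟨u, hu⟩ := hunit c (mem_ball_self hR) i
    have hinv := analyticAt_inverse (𝕜 := ℂ) u
    rw [hu] at hinv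
    exact AnalyticAt.fun_comp (f := fun t : Fin n → ℂ => coord i - algebraMap ℂ C(X, ℂ) (t i))
      hinv hlin
  have hrepr : ∀ t ∈ ball c R, ((2 * Real.pi * I : ℂ) ^ n)⁻¹ • Λ (K t) = f t := by
    intro t ht
    rw [inv_smul_eq_iff₀ (by simp [Real.pi_ne_zero]),
      ← torusIntegral_cauchy_kernel_smul hR n f c (hc.mono hRD) (fun z hz => hd z (hRD hz)) t ht]
    have hK : ∀ θ, K t θ = ∏ i, (torusMap c (fun _ => R) θ.1 i - t i)⁻¹ := by
      intro θ
      simp only [K, ContinuousMap.prod_apply]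
      refine Finset.prod_congr rfl fun i _ => ?_
      refine eq_inv_of_mul_eq_one_left ?_
      have h1 := congrArg (fun h : C(X, ℂ) => h θ) (Ring.inverse_mul_cancel _ (hunit t ht i))
      simpa [coord, Algebra.algebraMap_eq_smul_one] using h1
    change ∫ θ, K t θ • F θ ∂μ = _
    rw [torusIntegral, ← integral_subtype_comap measurableSet_Icc]
    refine integral_congr_ae (Filter.Eventually.of_forall fun θ => ?_)
    simp only [hK, F, ContinuousMap.coe_mk]
    rw [smul_comm]
  refine AnalyticAt.congr (f := fun t => ((2 * Real.pi * I : ℂ) ^ n)⁻¹ • Λ (K t)) ?_ ?_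
  · exact analyticAt_const.smul ((Λ.analyticAt _).comp hKan)
  · exact Filter.eventually_of_mem (ball_mem_nhds c hR) hrepr

/-! ### Divergence theorem on `ℝ^M` and holomorphic parametric integrals -/

open MeasureTheory Filter Topology Metric in
/-- The divergence of a differentiable vector field on `ℝ^M` integrates to zero if it is integrable
and the `i`-th component of the field is dominated by `q (s i) * ∏_{j ≠ i} p (s j)`, where `p` is
integrable and `q` is even and tends to zero at infinity: the flux through the faces of a large
cube tends to zero. Only the divergence as a whole is assumed integrable, not its separate terms.
-/
theorem integral_sum_fderiv_eq_zero {E : Type*} [NormedAddCommGroup E] [NormedSpace ℝ E]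
    [CompleteSpace E] {M : ℕ} {F : Fin M → (Fin M → ℝ) → E} (hF : ∀ i, Differentiable ℝ (F i))
    (hint : Integrable fun s => ∑ i, fderiv ℝ (F i) s (Pi.single i 1)) {p q : ℝ → ℝ}
    (hp : Integrable p) (hq : Tendsto q atTop (𝓝 0))
    (hq' : ∀ s, q (-s) = q s) {C : Fin M → ℝ}
    (hb : ∀ i s, ‖F i s‖ ≤ C i * (q (s i) * ∏ j ∈ Finset.univ.erase i, p (s j))) :
    ∫ s, ∑ i, fderiv ℝ (F i) s (Pi.single i 1) = 0 := by
  cases M with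
  | zero => simp
  | succ n =>
    set J := ∫ x : Fin n → ℝ, ∏ j, p (x j) with hJ
    have hJint : Integrable fun x : Fin n → ℝ => ∏ j, p (x j) :=
      Integrable.fintype_prod (f := fun _ => p) fun _ => hp
    -- The flux through the faces `s i = ± R` is bounded by a multiple of `q R`.
    have hface : ∀ (i : Fin (n + 1)) (R y : ℝ), q y = q R → ∀ A : Set (Fin n → ℝ),
        ‖∫ x in A, F i (i.insertNth y x)‖ ≤ C i * q R * J := by
      intro i R y hy A
      have hle : ∀ x : Fin n → ℝ, ‖F i (i.insertNth y x)‖ ≤ C i * q R * ∏ j, p (x j) := by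
        intro x
        refine (hb i _).trans_eq ?_
        rw [← Finset.compl_singleton, ← Fin.image_succAbove_univ,
          Finset.prod_image i.succAbove_right_injective.injOn]
        simp only [Fin.insertNth_apply_same, Fin.insertNth_apply_succAbove, hy, mul_assoc]
      have h₁ := norm_integral_le_of_norm_le ((hJint.const_mul (C i * q R)).restrict (s := A))
        (Eventually.of_forall hle)
      refine h₁.trans ?_
      have hnn : ∀ x : Fin n → ℝ, 0 ≤ C i * q R * ∏ j, p (x j) := fun x =>
        (norm_nonneg _).trans (hle x)
      refine (setIntegral_le_integral (hJint.const_mul (C i * q R))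
        (Eventually.of_forall hnn)).trans_eq ?_
      rw [integral_const_mul]
    have hbox : ∀ R : ℝ, 0 ≤ R →
        ‖∫ s in Set.Icc (fun _ : Fin (n + 1) => -R) fun _ => R,
          ∑ i, fderiv ℝ (F i) s (Pi.single i 1)‖ ≤ ∑ i, (C i * q R * J + C i * q R * J) := by
      intro R hR
      rw [integral_divergence_of_hasFDerivAt_off_countable' (fun _ => -R) (fun _ => R)
        (fun _ => by linarith) F (fun i s => fderiv ℝ (F i) s) ∅ Set.countable_empty
        (fun i => (hF i).continuous.continuousOn) (fun s _ i => (hF i s).hasFDerivAt)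
        hint.integrableOn]
      refine (norm_sum_le _ _).trans (Finset.sum_le_sum fun i _ => (norm_sub_le _ _).trans ?_)
      exact add_le_add (hface i R R rfl _) (hface i R (-R) (hq' R) _)
    have hlim₁ : Tendsto (fun R : ℝ => ∫ s in Set.Icc (fun _ : Fin (n + 1) => -R) fun _ => R,
        ∑ i, fderiv ℝ (F i) s (Pi.single i 1)) atTop
        (𝓝 (∫ s, ∑ i, fderiv ℝ (F i) s (Pi.single i 1))) := by
      refine (aecover_Icc ?_ ?_).integral_tendsto_of_countably_generated hint
      · exact tendsto_atBot.2 fun a => by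
          obtain ⟨B, hB⟩ := (Set.finite_range a).bddBelow
          filter_upwards [eventually_ge_atTop (-B)] with R hR i
          linarith [hB (Set.mem_range_self i)]
      · exact tendsto_atTop.2 fun a => by
          obtain ⟨B, hB⟩ := (Set.finite_range a).bddAbove
          filter_upwards [eventually_ge_atTop B] with R hR i
          linarith [hB (Set.mem_range_self i)]
    have hlim₂ : Tendsto (fun R : ℝ => ∑ i, (C i * q R * J + C i * q R * J)) atTop (𝓝 0) := by
      have : Tendsto (fun R : ℝ => ∑ i, (C i * q R * J + C i * q R * J)) atTop
          (𝓝 (∑ i, (C i * 0 * J + C i * 0 * J))) :=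
        tendsto_finsetSum _ fun i _ =>
          ((hq.const_mul (C i)).mul_const J).add ((hq.const_mul (C i)).mul_const J)
      simpa using this
    refine tendsto_nhds_unique hlim₁ (squeeze_zero_norm' ?_ hlim₂)
    filter_upwards [eventually_ge_atTop 0] with R hR using hbox R hR

open MeasureTheory Filter Topology Metric in
/-- An integral depending holomorphically on a parameter may be differentiated under the integral
sign as soon as the integrand itself is dominated: Cauchy's estimate dominates its derivative. -/
theorem hasDerivAt_integral_of_differentiableOn {α E : Type*} [MeasurableSpace α]
    {μ : Measure α} [NormedAddCommGroup E] [NormedSpace ℂ E] {F : ℂ → α → E} {z₀ : ℂ} {R : ℝ}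
    (hR : 0 < R) {bound : α → ℝ} (hmeas : ∀ z ∈ ball z₀ (2 * R), AEStronglyMeasurable (F z) μ)
    (hb : ∀ z ∈ ball z₀ (2 * R), ∀ a, ‖F z a‖ ≤ bound a)
    (hd : ∀ a, ∀ z ∈ ball z₀ (2 * R), DifferentiableAt ℂ (fun z => F z a) z)
    (hbound : Integrable bound μ) :
    Integrable (fun a => deriv (fun z => F z a) z₀) μ ∧
      HasDerivAt (fun z => ∫ a, F z a ∂μ) (∫ a, deriv (fun z => F z a) z₀ ∂μ) z₀ := by
  have hz₀ : z₀ ∈ ball z₀ (2 * R) := mem_ball_self (by positivity)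
  refine hasDerivAt_integral_of_dominated_loc_of_deriv_le (F := F)
    (F' := fun z a => deriv (fun z => F z a) z) (bound := fun a => bound a / (R / 2))
    (ball_mem_nhds z₀ hR) ?_ ?_ ?_ ?_ (hbound.div_const _) ?_
  · exact eventually_of_mem (ball_mem_nhds z₀ (by positivity)) hmeas
  · exact hbound.mono' (hmeas z₀ hz₀) (Eventually.of_forall (hb z₀ hz₀))
  · have hn : ∀ n : ℕ, z₀ + ((R / (n + 1) : ℝ) : ℂ) ∈ ball z₀ (2 * R) := by
      intro n
      have h₁ : R / ((n : ℝ) + 1) ≤ R := div_le_self hR.le (by linarith [n.cast_nonneg (α := ℝ)])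
      have h₂ : 0 < R / ((n : ℝ) + 1) := by positivity
      rw [mem_ball, dist_self_add_left, Complex.norm_real, Real.norm_eq_abs, abs_of_pos h₂]
      linarith
    -- The derivative is measurable as a limit of difference quotients.
    refine aestronglyMeasurable_of_tendsto_ae atTop (f := fun (n : ℕ) a =>
      ((R / (n + 1) : ℝ) : ℂ)⁻¹ • (F (z₀ + ((R / (n + 1) : ℝ) : ℂ)) a - F z₀ a))
      (fun n => ((hmeas _ (hn n)).sub (hmeas _ hz₀)).const_smul _)
      (Eventually.of_forall fun a => ?_)
    refine (hd a z₀ hz₀).hasDerivAt.tendsto_slope_zero.comp ?_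
    refine tendsto_nhdsWithin_iff.2 ⟨?_, Eventually.of_forall fun n => ?_⟩
    · rw [← Complex.ofReal_zero]
      refine (Complex.continuous_ofReal.tendsto 0).comp ?_
      exact tendsto_const_nhds.div_atTop (tendsto_natCast_atTop_atTop.atTop_add tendsto_const_nhds)
    · have : R / ((n : ℝ) + 1) ≠ 0 := by positivity
      exact Complex.ofReal_ne_zero.2 this
  · refine Eventually.of_forall fun a z hz => ?_
    have hsub : closedBall z (R / 2) ⊆ ball z₀ (2 * R) := by
      refine closedBall_subset_ball' ?_
      rw [mem_ball] at hz
      linarith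
    refine Complex.norm_deriv_le_of_forall_mem_sphere_norm_le (by positivity) ?_ fun w hw =>
      hb w (hsub (sphere_subset_closedBall hw)) a
    refine DifferentiableOn.diffContOnCl fun w hw => ?_
    exact (hd a w (hsub (closure_ball_subset_closedBall hw))).differentiableWithinAt
  · exact Eventually.of_forall fun a z hz =>
      (hd a z (ball_subset_ball (by linarith) hz)).hasDerivAt

noncomputable section

namespace BoundaryKZ

/-! ### The functions `b`, `b'` and the scalar identities -/

section

open Complex

/-- The constant `ε` with `b'' = ε b` and `b' ^ 2 = 1 + ε b ^ 2`; through it both chains are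
treated at once. -/
def eps : Chain → ℂ
  | .xxx => 0
  | .xxz => 1

theorem b'_xxx (x : ℂ) : b' .xxx x = 1 := by simp [b', b]

theorem b'_xxz (x : ℂ) : b' .xxz x = Complex.cosh x := by
  have : b .xxz = Complex.sinh := rfl
  simp [b', this]

theorem hasDerivAt_b (c : Chain) (x : ℂ) : HasDerivAt (b c) (b' c x) x := by
  cases c
  · rw [b'_xxx]; exact hasDerivAt_id x
  · rw [b'_xxz]; exact Complex.hasDerivAt_sinh x

theorem hasDerivAt_b' (c : Chain) (x : ℂ) : HasDerivAt (b' c) (eps c * b c x) x := by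
  cases c
  · have : b' .xxx = fun _ => 1 := funext b'_xxx
    rw [this]; simpa [eps] using hasDerivAt_const x (1 : ℂ)
  · have : b' .xxz = Complex.cosh := funext b'_xxz
    rw [this]; simpa [eps, b] using Complex.hasDerivAt_cosh x

theorem b_add (c : Chain) (x y : ℂ) : b c (x + y) = b c x * b' c y + b' c x * b c y := by
  cases c
  · simp [b, b'_xxx]
  · simp only [b, b'_xxz, Complex.sinh_add]

theorem b_neg (c : Chain) (x : ℂ) : b c (-x) = -b c x := by
  cases c <;> simp [b]

theorem b'_neg (c : Chain) (x : ℂ) : b' c (-x) = b' c x := by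
  cases c <;> simp [b'_xxx, b'_xxz]

theorem b'_zero (c : Chain) : b' c 0 = 1 := by
  cases c <;> simp [b'_xxx, b'_xxz]

theorem b'_add (c : Chain) (x y : ℂ) :
    b' c (x + y) = b' c x * b' c y + eps c * (b c x * b c y) := by
  cases c
  · simp [eps, b'_xxx]
  · simp only [b, b'_xxz, Complex.cosh_add, eps, one_mul]

theorem b_sub (c : Chain) (x y : ℂ) : b c (x - y) = b c x * b' c y - b' c x * b c y := by
  rw [sub_eq_add_neg, b_add, b_neg, b'_neg]; ring

theorem b_sub_comm (c : Chain) (x y : ℂ) : b c (x - y) = -b c (y - x) := by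
  rw [← b_neg, neg_sub]

theorem b'_sub (c : Chain) (x y : ℂ) :
    b' c (x - y) = b' c x * b' c y - eps c * (b c x * b c y) := by
  rw [sub_eq_add_neg, b'_add, b_neg, b'_neg]; ring

theorem b'_sq (c : Chain) (x : ℂ) : b' c x ^ 2 = 1 + eps c * b c x ^ 2 := by
  cases c
  · simp [eps, b'_xxx]
  · simp only [b, b'_xxz, eps, Complex.cosh_sq]; ring

theorem b_add_mul_b_sub (c : Chain) (x y : ℂ) :
    b c (x + y) * b c (x - y) = b c x ^ 2 - b c y ^ 2 := by
  rw [b_add, b_sub]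
  linear_combination b c x ^ 2 * b'_sq c y - b c y ^ 2 * b'_sq c x

theorem sq_sub_sq_ne_zero {c : Chain} {x y : ℂ} (h₁ : b c (x + y) ≠ 0) (h₂ : b c (x - y) ≠ 0) :
    b c x ^ 2 - b c y ^ 2 ≠ 0 := by
  rw [← b_add_mul_b_sub]; exact mul_ne_zero h₁ h₂

/-- The logarithmic derivative `b' / b`. -/
def rho (c : Chain) (x : ℂ) : ℂ := b' c x / b c x

theorem rho_neg (c : Chain) (x : ℂ) : rho c (-x) = -rho c x := by
  rw [rho, b_neg, b'_neg, div_neg, rho]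

/-- The coefficient of `σ_r^-` in `β(x;t)`, as a function of `x` and `t_r`. -/
def phi (c : Chain) (x t : ℂ) : ℂ := 2 * b' c x * (b c t / (b c (x + t) * b c (x - t)))

/-- The companion of `phi`, equal to `1 / b(x-t) + 1 / b(x+t)`. It plays the role of a primitive:
its `x`-derivative is minus the `t`-derivative of `phi`. -/
def psi (c : Chain) (x t : ℂ) : ℂ := 2 * b c x * (b' c t / (b c (x + t) * b c (x - t)))

theorem phi_eq (c : Chain) (x t : ℂ) :
    phi c x t = 2 * b' c x * b c t / (b c x ^ 2 - b c t ^ 2) := by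
  rw [phi, b_add_mul_b_sub, mul_div_assoc]

theorem psi_eq (c : Chain) (x t : ℂ) :
    psi c x t = 2 * b c x * b' c t / (b c x ^ 2 - b c t ^ 2) := by
  rw [psi, b_add_mul_b_sub, mul_div_assoc]

theorem rho_add_rho {c : Chain} {x y : ℂ} (h₁ : b c (x + y) ≠ 0) (h₂ : b c (x - y) ≠ 0) :
    rho c (x + y) + rho c (x - y) = 2 * b c x * b' c x / (b c x ^ 2 - b c y ^ 2) := by
  rw [← b_add_mul_b_sub, rho, rho, div_add_div _ _ h₁ h₂]
  congr 1
  rw [b_add, b_sub, b'_add, b'_sub]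
  linear_combination (2 * b c x * b' c x) * b'_sq c y

variable {c : Chain}

theorem phi_eq_sub {x t : ℂ} (h₁ : b c (x + t) ≠ 0) (h₂ : b c (x - t) ≠ 0) :
    phi c x t = 1 / b c (x - t) - 1 / b c (x + t) := by
  rw [phi, div_sub_div _ _ h₂ h₁, ← mul_div_assoc, mul_comm (b c (x + t))]
  congr 1
  rw [b_add, b_sub]; ring

theorem psi_eq_add {x t : ℂ} (h₁ : b c (x + t) ≠ 0) (h₂ : b c (x - t) ≠ 0) :
    psi c x t = 1 / b c (x - t) + 1 / b c (x + t) := by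
  rw [psi, div_add_div _ _ h₂ h₁, ← mul_div_assoc, mul_comm (b c (x + t))]
  congr 1
  rw [b_add, b_sub]; ring

/-- The common value of `∂φ/∂t` and `-∂ψ/∂x`. -/
def dphi (c : Chain) (x t : ℂ) : ℂ :=
  b' c (x - t) / b c (x - t) ^ 2 + b' c (x + t) / b c (x + t) ^ 2

theorem hasDerivAt_phi {x t : ℂ} (h₁ : b c (x + t) ≠ 0) (h₂ : b c (x - t) ≠ 0) :
    HasDerivAt (fun z => phi c x z) (dphi c x t) t := by
  have e₁ : HasDerivAt (fun z => b c (x + z)) (b' c (x + t)) t :=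
    (hasDerivAt_b c (x + t)).comp_const_add x t
  have e₂ : HasDerivAt (fun z => b c (x - z)) (-b' c (x - t)) t :=
    (hasDerivAt_b c (x - t)).comp_const_sub x t
  have key := (e₂.inv h₂).sub (e₁.inv h₁)
  have hev : (fun z => phi c x z) =ᶠ[nhds t] fun z => (b c (x - z))⁻¹ - (b c (x + z))⁻¹ := by
    filter_upwards [e₁.continuousAt.eventually_ne h₁, e₂.continuousAt.eventually_ne h₂]
      with z hz₁ hz₂
    rw [phi_eq_sub hz₁ hz₂, one_div, one_div]
  refine (key.congr_of_eventuallyEq hev).congr_deriv ?_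
  rw [dphi]; ring

theorem hasDerivAt_psi {x t : ℂ} (h₁ : b c (x + t) ≠ 0) (h₂ : b c (x - t) ≠ 0) :
    HasDerivAt (fun z => psi c z t) (-dphi c x t) x := by
  have e₁ : HasDerivAt (fun z => b c (z + t)) (b' c (x + t)) x :=
    (hasDerivAt_b c (x + t)).comp_add_const x t
  have e₂ : HasDerivAt (fun z => b c (z - t)) (b' c (x - t)) x :=
    (hasDerivAt_b c (x - t)).comp_sub_const x t
  have key := (e₂.inv h₂).add (e₁.inv h₁)
  have hev : (fun z => psi c z t) =ᶠ[nhds x] fun z => (b c (z - t))⁻¹ + (b c (z + t))⁻¹ := by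
    filter_upwards [e₁.continuousAt.eventually_ne h₁, e₂.continuousAt.eventually_ne h₂]
      with z hz₁ hz₂
    rw [psi_eq_add hz₁ hz₂, one_div, one_div]
  refine (key.congr_of_eventuallyEq hev).congr_deriv ?_
  rw [dphi]; ring

theorem sq_sub_sq_ne_zero' {x y : ℂ} (h₁ : b c (x + y) ≠ 0) (h₂ : b c (x - y) ≠ 0) :
    b c y ^ 2 - b c x ^ 2 ≠ 0 := by
  rw [← neg_sub]; exact neg_ne_zero.2 (sq_sub_sq_ne_zero h₁ h₂)

theorem rho_add_rho_swap {x t : ℂ} (h₁ : b c (x + t) ≠ 0) (h₂ : b c (x - t) ≠ 0) :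
    rho c (t + x) + rho c (t - x) = 2 * b c t * b' c t / (b c t ^ 2 - b c x ^ 2) :=
  rho_add_rho (by rwa [add_comm]) (by rwa [b_sub_comm, neg_ne_zero])

/-- The coefficient of `σ_s^-` in the one-body identity for `a_r`, with `t = t_r`, `s = t_s`. -/
theorem one_body_other {x t s : ℂ} (xt₁ : b c (x + t) ≠ 0) (xt₂ : b c (x - t) ≠ 0)
    (xs₁ : b c (x + s) ≠ 0) (xs₂ : b c (x - s) ≠ 0)
    (ts₁ : b c (t + s) ≠ 0) (ts₂ : b c (t - s) ≠ 0) :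
    phi c t s * phi c x t - (rho c (t + s) + rho c (t - s)) * phi c x s =
      -(rho c (t + x) + rho c (t - x)) * phi c x s := by
  rw [rho_add_rho_swap xt₁ xt₂, rho_add_rho ts₁ ts₂]
  simp only [phi_eq]
  have h₁ := sq_sub_sq_ne_zero xt₁ xt₂
  have h₁' := sq_sub_sq_ne_zero' xt₁ xt₂
  have h₂ := sq_sub_sq_ne_zero xs₁ xs₂
  have h₃ := sq_sub_sq_ne_zero ts₁ ts₂
  field_simp
  ring

/-- The contribution of the leg `s ≠ r` to the coefficient of `σ_r^-` in the one-body identity for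
`a_r`, with `t = t_r`, `s = t_s`. -/
theorem one_body_exchange {x t s : ℂ} (xt₁ : b c (x + t) ≠ 0) (xt₂ : b c (x - t) ≠ 0)
    (xs₁ : b c (x + s) ≠ 0) (xs₂ : b c (x - s) ≠ 0)
    (ts₁ : b c (t + s) ≠ 0) (ts₂ : b c (t - s) ≠ 0) :
    phi c t s * phi c x s - (rho c (t + s) + rho c (t - s)) * phi c x t =
      -(rho c (x + s) + rho c (x - s)) * psi c x t := by
  rw [rho_add_rho xs₁ xs₂, rho_add_rho ts₁ ts₂]
  simp only [phi_eq, psi_eq]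
  have h₁ := sq_sub_sq_ne_zero xt₁ xt₂
  have h₂ := sq_sub_sq_ne_zero xs₁ xs₂
  have h₃ := sq_sub_sq_ne_zero ts₁ ts₂
  field_simp
  ring

/-- The contribution of the boundary term `κ_r` to the coefficient of `σ_r^-` in the one-body
identity for `a_r`, with `t = t_r`. -/
theorem one_body_self {x t : ℂ} (Δ : ℂ) (hx : b c x ≠ 0) (ht : b c t ≠ 0)
    (xt₁ : b c (x + t) ≠ 0) (xt₂ : b c (x - t) ≠ 0) :
    -(2 * Δ * rho c t) * phi c x t = -(rho c (t + x) + rho c (t - x)) * phi c x t +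
      (2 * (1 - Δ) * rho c x - (rho c (x + t) + rho c (x - t))) * psi c x t := by
  rw [rho_add_rho_swap xt₁ xt₂, rho_add_rho xt₁ xt₂]
  simp only [phi_eq, psi_eq, rho]
  have h₁ := sq_sub_sq_ne_zero xt₁ xt₂
  have h₁' := sq_sub_sq_ne_zero' xt₁ xt₂
  field_simp
  ring

/-- The coefficient of `σ_r^- σ_s^-` in the double commutator of `a_r` with two lowering operators,
divided by `2`, with `t = t_r`, `s = t_s`. -/
theorem two_body {x y t s : ℂ} (xt₁ : b c (x + t) ≠ 0) (xt₂ : b c (x - t) ≠ 0)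
    (xs₁ : b c (x + s) ≠ 0) (xs₂ : b c (x - s) ≠ 0)
    (yt₁ : b c (y + t) ≠ 0) (yt₂ : b c (y - t) ≠ 0)
    (ys₁ : b c (y + s) ≠ 0) (ys₂ : b c (y - s) ≠ 0)
    (xy₁ : b c (x + y) ≠ 0) (xy₂ : b c (x - y) ≠ 0)
    (ts₁ : b c (t + s) ≠ 0) (ts₂ : b c (t - s) ≠ 0) :
    (rho c (t + s) + rho c (t - s)) * (phi c x t * phi c y s + phi c x s * phi c y t) -
        phi c t s * (phi c x t * phi c y t + phi c x s * phi c y s) =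
      (rho c (x + y) + rho c (x - y)) * psi c x t * phi c y s +
        (rho c (y + x) + rho c (y - x)) * psi c y t * phi c x s := by
  rw [rho_add_rho_swap xy₁ xy₂, rho_add_rho ts₁ ts₂, rho_add_rho xy₁ xy₂]
  simp only [phi_eq, psi_eq]
  have h₁ := sq_sub_sq_ne_zero xt₁ xt₂
  have h₂ := sq_sub_sq_ne_zero xs₁ xs₂
  have h₃ := sq_sub_sq_ne_zero ts₁ ts₂
  have h₄ := sq_sub_sq_ne_zero yt₁ yt₂
  have h₅ := sq_sub_sq_ne_zero ys₁ ys₂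
  have h₆ := sq_sub_sq_ne_zero xy₁ xy₂
  have h₆' := sq_sub_sq_ne_zero' xy₁ xy₂
  field_simp
  ring

/-- A continuous real function vanishing exactly on `𝓛` and invariant under real translations. -/
def cutFn : Chain → ℂ → ℝ
  | .xxx => fun z => z.im
  | .xxz => fun z => Real.sin z.im

theorem mem_cutLines_iff (z : ℂ) : z ∈ cutLines c ↔ cutFn c z = 0 := by
  cases c
  · constructor
    · rintro ⟨y, rfl⟩; simp [cutFn]
    · intro h; exact ⟨z.re, Complex.ext (by simp) (by simpa [cutFn] using h)⟩
  · simp only [cutLines, cutFn, Set.mem_ofPred_eq, Real.sin_eq_zero_iff]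
    constructor
    · rintro ⟨y, n, rfl⟩; exact ⟨n, by simp; ring⟩
    · rintro ⟨n, hn⟩
      exact ⟨z.re, n, Complex.ext (by simp) (by simp [← hn]; ring)⟩

theorem continuous_cutFn (c : Chain) : Continuous (cutFn c) := by
  cases c
  · exact Complex.continuous_im
  · exact Real.continuous_sin.comp Complex.continuous_im

theorem isClosed_cutLines (c : Chain) : IsClosed (cutLines c) := by
  have : cutLines c = cutFn c ⁻¹' {0} := by ext z; exact mem_cutLines_iff z
  rw [this]; exact isClosed_singleton.preimage (continuous_cutFn c)

theorem add_ofReal_notMem {z : ℂ} (hz : z ∉ cutLines c) (s : ℝ) : z + s ∉ cutLines c := by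
  rw [mem_cutLines_iff] at *
  cases c <;> simpa [cutFn] using hz

theorem neg_notMem {z : ℂ} (hz : z ∉ cutLines c) : -z ∉ cutLines c := by
  rw [mem_cutLines_iff] at *
  cases c <;> simpa [cutFn] using hz

theorem b_xxz_im (z : ℂ) : (b .xxz z).im = Real.cosh z.re * Real.sin z.im := by
  change (Complex.sinh z).im = _
  conv_lhs => rw [← Complex.re_add_im z, Complex.sinh_add, Complex.sinh_mul_I,
    Complex.cosh_mul_I]
  simp [← Complex.ofReal_sinh, ← Complex.ofReal_cosh, ← Complex.ofReal_sin, ← Complex.ofReal_cos]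

theorem b_im_ne_zero {z : ℂ} (hz : z ∉ cutLines c) : (b c z).im ≠ 0 := by
  rw [mem_cutLines_iff] at hz
  cases c
  · exact hz
  · rw [b_xxz_im]
    exact mul_ne_zero (Real.cosh_pos _).ne' hz

theorem b_mem_slitPlane {z : ℂ} (hz : z ∉ cutLines c) : b c z ∈ slitPlane :=
  Or.inr (b_im_ne_zero hz)

theorem b_ne_zero {z : ℂ} (hz : z ∉ cutLines c) : b c z ≠ 0 :=
  slitPlane_ne_zero (b_mem_slitPlane hz)

end

/-! ### Commutators of `a_r` with lowering operators -/

section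

open Complex Function Matrix
open scoped Kronecker

variable {N : ℕ}

theorem sum_agree_leg {R : Type*} [AddCommMonoid R] (r : Fin N) (σ : Fin N → Fin 2)
    (F : (Fin N → Fin 2) → R) :
    (∑ τ, if ∀ q, q ≠ r → σ q = τ q then F τ else 0) = ∑ a, F (update σ r a) := by
  rw [← Finset.sum_filter]
  refine (Finset.sum_bij (fun a _ => update σ r a) ?_ ?_ ?_ fun _ _ => rfl).symm
  · intro a _
    simp only [Finset.mem_filter, Finset.mem_univ, true_and]
    intro q hq
    rw [update_of_ne hq]
  · intro a _ a' _ h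
    exact update_injective σ r h
  · intro τ hτ
    simp only [Finset.mem_filter, Finset.mem_univ, true_and] at hτ
    refine ⟨τ r, Finset.mem_univ _, ?_⟩
    ext q
    rcases eq_or_ne q r with rfl | h
    · simp
    · rw [update_of_ne h, hτ q h]

theorem sum_agree_legs {R : Type*} [AddCommMonoid R] {r s : Fin N} (hrs : r ≠ s) (σ : Fin N → Fin 2)
    (F : (Fin N → Fin 2) → R) :
    (∑ τ, if ∀ q, q ≠ r → q ≠ s → σ q = τ q then F τ else 0) =
      ∑ p : Fin 2 × Fin 2, F (update (update σ r p.1) s p.2) := by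
  rw [← Finset.sum_filter]
  refine (Finset.sum_bij (fun p _ => update (update σ r p.1) s p.2) ?_ ?_ ?_ fun _ _ => rfl).symm
  · intro p _
    simp only [Finset.mem_filter, Finset.mem_univ, true_and]
    intro q hq hq'
    rw [update_of_ne hq', update_of_ne hq]
  · intro p _ p' _ h
    have h₁ := congrFun h r
    have h₂ := congrFun h s
    simp only [update_of_ne hrs, update_self] at h₁ h₂
    exact Prod.ext h₁ h₂
  · intro τ hτ
    simp only [Finset.mem_filter, Finset.mem_univ, true_and] at hτ
    refine ⟨(τ r, τ s), Finset.mem_univ _, ?_⟩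
    ext q
    rcases eq_or_ne q s with rfl | h
    · simp
    rcases eq_or_ne q r with rfl | h'
    · simp [hrs]
    · rw [update_of_ne h, update_of_ne h', hτ q h' h]

theorem leg_mul_apply (r : Fin N) (A : Matrix (Fin 2) (Fin 2) ℂ) (X : Op N) (σ υ : Fin N → Fin 2) :
    (leg r A * X) σ υ = ∑ a, A (σ r) a * X (update σ r a) υ := by
  have := sum_agree_leg r σ fun τ => A (σ r) (τ r) * X τ υ
  simp only [update_self] at this
  rw [← this, Matrix.mul_apply]
  simp only [leg, ite_mul, zero_mul]

theorem mul_leg_apply (r : Fin N) (A : Matrix (Fin 2) (Fin 2) ℂ) (X : Op N) (σ υ : Fin N → Fin 2) :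
    (X * leg r A) σ υ = ∑ a, X σ (update υ r a) * A a (υ r) := by
  have := sum_agree_leg r υ fun τ => X σ τ * A (τ r) (υ r)
  simp only [update_self] at this
  rw [← this, Matrix.mul_apply]
  refine Finset.sum_congr rfl fun τ _ => ?_
  simp only [leg, mul_ite, mul_zero, eq_comm]

theorem legs_mul_apply {r s : Fin N} (hrs : r ≠ s) (B : Matrix (Fin 2 × Fin 2) (Fin 2 × Fin 2) ℂ)
    (X : Op N) (σ υ : Fin N → Fin 2) :
    (legs r s B * X) σ υ =
      ∑ p : Fin 2 × Fin 2, B (σ r, σ s) p * X (update (update σ r p.1) s p.2) υ := by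
  have := sum_agree_legs hrs σ fun τ => B (σ r, σ s) (τ r, τ s) * X τ υ
  simp only [update_self, update_of_ne hrs] at this
  rw [← this, Matrix.mul_apply]
  simp only [legs, ite_mul, zero_mul]

theorem leg_mul (r : Fin N) (A B : Matrix (Fin 2) (Fin 2) ℂ) :
    leg r (A * B) = leg r A * leg r B := by
  ext σ υ
  rw [leg_mul_apply]
  simp only [leg, Matrix.mul_apply, update_self]
  have h : ∀ a, (∀ q, q ≠ r → update σ r a q = υ q) ↔ ∀ q, q ≠ r → σ q = υ q := fun a =>
    forall_congr' fun q => imp_congr_right fun hq => by rw [update_of_ne hq]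
  simp only [h]
  split_ifs <;> simp

theorem legs_mul {r s : Fin N} (hrs : r ≠ s) (A B : Matrix (Fin 2 × Fin 2) (Fin 2 × Fin 2) ℂ) :
    legs r s (A * B) = legs r s A * legs r s B := by
  ext σ υ
  rw [legs_mul_apply hrs]
  simp only [legs, Matrix.mul_apply, update_self, update_of_ne hrs]
  have h : ∀ p : Fin 2 × Fin 2,
      (∀ q, q ≠ r → q ≠ s → update (update σ r p.1) s p.2 q = υ q) ↔
        ∀ q, q ≠ r → q ≠ s → σ q = υ q := fun a =>
    forall_congr' fun q => imp_congr_right fun hq => imp_congr_right fun hq' => by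
      rw [update_of_ne hq', update_of_ne hq]
  simp only [h]
  split_ifs <;> simp

theorem legs_add (r s : Fin N) (A B : Matrix (Fin 2 × Fin 2) (Fin 2 × Fin 2) ℂ) :
    legs r s (A + B) = legs r s A + legs r s B := by
  ext σ τ; simp only [legs, Matrix.add_apply]; split_ifs <;> simp

theorem legs_sub (r s : Fin N) (A B : Matrix (Fin 2 × Fin 2) (Fin 2 × Fin 2) ℂ) :
    legs r s (A - B) = legs r s A - legs r s B := by
  ext σ τ; simp only [legs, Matrix.sub_apply]; split_ifs <;> simp

theorem legs_smul (r s : Fin N) (a : ℂ) (A : Matrix (Fin 2 × Fin 2) (Fin 2 × Fin 2) ℂ) :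
    legs r s (a • A) = a • legs r s A := by
  ext σ τ; simp only [legs, Matrix.smul_apply]; split_ifs <;> simp

theorem leg_smul (r : Fin N) (a : ℂ) (A : Matrix (Fin 2) (Fin 2) ℂ) :
    leg r (a • A) = a • leg r A := by
  ext σ τ; simp only [leg, Matrix.smul_apply]; split_ifs <;> simp

theorem leg_eq_legs_left {r s : Fin N} (hrs : r ≠ s) (A : Matrix (Fin 2) (Fin 2) ℂ) :
    leg r A = legs r s (A ⊗ₖ 1) := by
  ext σ τ
  simp only [leg, legs, kronecker_apply, Matrix.one_apply]
  by_cases h : ∀ q, q ≠ r → σ q = τ q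
  · rw [if_pos h, if_pos fun q hq _ => h q hq, if_pos (h s hrs.symm), mul_one]
  · rw [if_neg h]
    by_cases h' : ∀ q, q ≠ r → q ≠ s → σ q = τ q
    · rw [if_pos h', if_neg, mul_zero]
      intro hs
      refine h fun q hq => ?_
      rcases eq_or_ne q s with rfl | hqs
      exacts [hs, h' q hq hqs]
    · rw [if_neg h']

theorem leg_eq_legs_right {r s : Fin N} (hrs : r ≠ s) (A : Matrix (Fin 2) (Fin 2) ℂ) :
    leg s A = legs r s (1 ⊗ₖ A) := by
  ext σ τ
  simp only [leg, legs, kronecker_apply, Matrix.one_apply]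
  by_cases h : ∀ q, q ≠ s → σ q = τ q
  · rw [if_pos h, if_pos fun q _ hq => h q hq, if_pos (h r hrs), one_mul]
  · rw [if_neg h]
    by_cases h' : ∀ q, q ≠ r → q ≠ s → σ q = τ q
    · rw [if_pos h', if_neg, zero_mul]
      intro hs
      refine h fun q hq => ?_
      rcases eq_or_ne q r with rfl | hqs
      exacts [hs, h' q hqs hq]
    · rw [if_neg h']

theorem leg_commute_leg {r s : Fin N} (hrs : r ≠ s) (A B : Matrix (Fin 2) (Fin 2) ℂ) :
    Commute (leg r A) (leg s B) := by
  rw [leg_eq_legs_left hrs, leg_eq_legs_right hrs B, Commute, SemiconjBy, ← legs_mul hrs,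
    ← legs_mul hrs]
  congr 1
  have h₁ := mul_kronecker_mul A (1 : Matrix (Fin 2) (Fin 2) ℂ) (1 : Matrix (Fin 2) (Fin 2) ℂ) B
  have h₂ := mul_kronecker_mul (1 : Matrix (Fin 2) (Fin 2) ℂ) A B (1 : Matrix (Fin 2) (Fin 2) ℂ)
  simp only [Matrix.mul_one, Matrix.one_mul] at h₁ h₂
  exact h₁.symm.trans h₂

theorem leg_commute_legs {q r s : Fin N} (hqr : q ≠ r) (hqs : q ≠ s)
    (A : Matrix (Fin 2) (Fin 2) ℂ) (B : Matrix (Fin 2 × Fin 2) (Fin 2 × Fin 2) ℂ) :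
    Commute (leg q A) (legs r s B) := by
  ext σ υ
  rw [leg_mul_apply, mul_leg_apply]
  have key : ∀ (σ υ : Fin N → Fin 2) (a : Fin 2),
      legs r s B (update σ q a) υ = if a = υ q then
        (if ∀ p, p ≠ q → p ≠ r → p ≠ s → σ p = υ p then B (σ r, σ s) (υ r, υ s) else 0)
        else 0 := by
    intro σ υ a
    simp only [legs, update_of_ne hqr.symm, update_of_ne hqs.symm]
    rw [← ite_and]
    refine if_congr ⟨fun h => ⟨by simpa using h q hqr hqs, fun p hp h₁ h₂ => by
      simpa [update_of_ne hp] using h p h₁ h₂⟩, fun h p h₁ h₂ => ?_⟩ rfl rfl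
    rcases eq_or_ne p q with rfl | hp
    · simpa using h.1
    · rw [update_of_ne hp]; exact h.2 p hp h₁ h₂
  have key' : ∀ a, legs r s B σ (update υ q a) = if a = σ q then
        (if ∀ p, p ≠ q → p ≠ r → p ≠ s → σ p = υ p then B (σ r, σ s) (υ r, υ s) else 0)
        else 0 := by
    intro a
    have := key σ (update υ q a) (σ q)
    rw [update_eq_self] at this
    rw [this, update_self, update_of_ne hqr.symm, update_of_ne hqs.symm]
    refine if_congr eq_comm (if_congr (forall_congr' fun p => imp_congr_right fun hp => ?_) rfl rfl)
      rfl
    rw [update_of_ne hp]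
  simp only [key, key']
  simp [mul_comm]

/-- The lowering operator `∑ a_s σ_s^-`. -/
def lower (N : ℕ) : (Fin N → ℂ) →ₗ[ℂ] Op N :=
  ∑ s, (LinearMap.proj s).smulRight (leg s sigmaMinus)

theorem lower_apply (a : Fin N → ℂ) : lower N a = ∑ s, a s • leg s sigmaMinus := by
  simp [lower]

theorem lower_single (r : Fin N) : lower N (Pi.single r 1) = leg r sigmaMinus := by
  rw [lower_apply, Finset.sum_eq_single r] <;> simp +contextual

theorem lower_commute (a a' : Fin N → ℂ) : Commute (lower N a) (lower N a') := by
  rw [lower_apply, lower_apply]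
  refine Commute.sum_left _ _ _ fun r _ => Commute.sum_right _ _ _ fun s _ => ?_
  refine Commute.smul_left (Commute.smul_right ?_ _) _
  rcases eq_or_ne r s with rfl | h
  exacts [Commute.refl _, leg_commute_leg h _ _]

theorem beta_eq_lower (c : Chain) (x : ℂ) (t : Fin N → ℂ) :
    beta c x t = lower N fun s => phi c x (t s) := by
  simp only [beta, lower_apply, Finset.smul_sum, smul_smul, phi]

theorem mulVec_Omega (X : Op N) (σ : Fin N → Fin 2) : (X.mulVec (Omega N)) σ = X σ fun _ => 0 := by
  rw [Omega, Matrix.mulVec_single_one]; rfl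

/-- The operator on `ℂ² ⊗ ℂ²` with diagonal entries `-d` and off-diagonal entries `o` on the span
of `e₊ ⊗ e₋` and `e₋ ⊗ e₊`, and zero on `e₊ ⊗ e₊` and `e₋ ⊗ e₋`. Both `r(x)` and `Θ(x,y)` have this
form. -/
def hop (d o : ℂ) : Matrix (Fin 2 × Fin 2) (Fin 2 × Fin 2) ℂ := fun p q =>
  if p.1 = p.2 then 0 else if p = q then -d else if p = (q.2, q.1) then o else 0

theorem Theta_eq_hop (c : Chain) (x y : ℂ) : Theta c x y =
    hop (rho c (x - y) + rho c (x + y)) (1 / b c (x - y) - 1 / b c (x + y)) := by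
  have e : ∀ i j, finProdFinEquiv (m := 2) (n := 2) (i, j) = ![![0, 1], ![2, 3]] i j := by decide
  ext ⟨p₁, p₂⟩ ⟨q₁, q₂⟩
  simp only [Theta, Matrix.add_apply, Matrix.mul_apply, Fintype.sum_prod_type, Fin.sum_univ_two,
    rMat, Matrix.submatrix_apply, b'_zero, hop, rho, e]
  fin_cases p₁ <;> fin_cases p₂ <;> fin_cases q₁ <;> fin_cases q₂ <;>
    simp [sigmaZ] <;> ring

theorem hop_apply_zero (d o : ℂ) (p : Fin 2 × Fin 2) : hop d o p (0, 0) = 0 := by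
  obtain ⟨p₁, p₂⟩ := p
  fin_cases p₁ <;> fin_cases p₂ <;> simp [hop]

theorem legs_mulVec_Omega_congr {r s : Fin N}
    {B B' : Matrix (Fin 2 × Fin 2) (Fin 2 × Fin 2) ℂ} (h : ∀ p, B p (0, 0) = B' p (0, 0)) :
    (legs r s B).mulVec (Omega N) = (legs r s B').mulVec (Omega N) := by
  ext σ
  rw [mulVec_Omega, mulVec_Omega, legs, legs, h]

theorem legs_mulVec_Omega_eq_zero {r s : Fin N} {B : Matrix (Fin 2 × Fin 2) (Fin 2 × Fin 2) ℂ}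
    (h : ∀ p, B p (0, 0) = 0) : (legs r s B).mulVec (Omega N) = 0 := by
  ext σ
  rw [mulVec_Omega, legs, h, ite_self, Pi.zero_apply]

/-- The two-site lowering operator `u σ^- ⊗ 1 + v 1 ⊗ σ^-`. -/
def lowerPair (u v : ℂ) : Matrix (Fin 2 × Fin 2) (Fin 2 × Fin 2) ℂ :=
  u • sigmaMinus ⊗ₖ 1 + v • 1 ⊗ₖ sigmaMinus

theorem legs_lowerPair {r s : Fin N} (hrs : r ≠ s) (u v : ℂ) :
    legs r s (lowerPair u v) = u • leg r sigmaMinus + v • leg s sigmaMinus := by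
  rw [lowerPair, legs_add, legs_smul, legs_smul, ← leg_eq_legs_left hrs, ← leg_eq_legs_right hrs]

section Lie

-- The commutator bracket of a ring is not a global `LieRing` instance in Mathlib, so its
-- bilinearity is stated here for `Ring.instBracket`.

variable {A : Type*} [Ring A]

theorem ring_add_lie (x y z : A) : ⁅x + y, z⁆ = ⁅x, z⁆ + ⁅y, z⁆ := by
  simp only [Ring.lie_def]; noncomm_ring

theorem ring_lie_add (x y z : A) : ⁅x, y + z⁆ = ⁅x, y⁆ + ⁅x, z⁆ := by
  simp only [Ring.lie_def]; noncomm_ring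

theorem ring_neg_lie (x y : A) : ⁅-x, y⁆ = -⁅x, y⁆ := by
  simp only [Ring.lie_def]; noncomm_ring

theorem ring_smul_lie [Algebra ℂ A] (a : ℂ) (x y : A) : ⁅a • x, y⁆ = a • ⁅x, y⁆ := by
  simp only [Ring.lie_def, smul_mul_assoc, mul_smul_comm, smul_sub]

theorem ring_lie_smul [Algebra ℂ A] (a : ℂ) (x y : A) : ⁅x, a • y⁆ = a • ⁅x, y⁆ := by
  simp only [Ring.lie_def, smul_mul_assoc, mul_smul_comm, smul_sub]

theorem ring_sum_lie {ι : Type*} (s : Finset ι) (f : ι → A) (y : A) :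
    ⁅∑ i ∈ s, f i, y⁆ = ∑ i ∈ s, ⁅f i, y⁆ := by
  simp only [Ring.lie_def, Finset.sum_mul, Finset.mul_sum, Finset.sum_sub_distrib]

theorem ring_lie_sum {ι : Type*} (s : Finset ι) (x : A) (f : ι → A) :
    ⁅x, ∑ i ∈ s, f i⁆ = ∑ i ∈ s, ⁅x, f i⁆ := by
  simp only [Ring.lie_def, Finset.sum_mul, Finset.mul_sum, Finset.sum_sub_distrib]

end Lie

theorem legs_lie_lower {r s : Fin N} (hrs : r ≠ s)
    (B : Matrix (Fin 2 × Fin 2) (Fin 2 × Fin 2) ℂ) (a : Fin N → ℂ) :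
    ⁅legs r s B, lower N a⁆ = legs r s ⁅B, lowerPair (a r) (a s)⁆ := by
  have h : lower N a = legs r s (lowerPair (a r) (a s)) +
      ∑ q ∈ (Finset.univ.erase r).erase s, a q • leg q sigmaMinus := by
    rw [lower_apply, legs_lowerPair hrs, add_assoc,
      Finset.add_sum_erase _ (fun q => a q • leg q sigmaMinus) (by simp [hrs.symm]),
      Finset.add_sum_erase _ (fun q => a q • leg q sigmaMinus) (Finset.mem_univ r)]
  have h₀ : ⁅legs r s B, ∑ q ∈ (Finset.univ.erase r).erase s, a q • leg q sigmaMinus⁆ = 0 := by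
    rw [← commute_iff_lie_eq]
    refine Commute.sum_right _ _ _ fun q hq => Commute.smul_right ?_ _
    simp only [Finset.mem_erase, Finset.mem_univ, and_true] at hq
    exact (leg_commute_legs hq.2 hq.1 _ _).symm
  rw [h, ring_lie_add, h₀, add_zero, Ring.lie_def, Ring.lie_def, legs_sub, legs_mul hrs,
    legs_mul hrs]

/-- On `e₊ ⊗ e₊` the commutator of a hopping operator with a lowering operator is again a lowering
operator. -/
theorem hop_lie_lowerPair_apply_zero (d o u v : ℂ) (p : Fin 2 × Fin 2) :
    ⁅hop d o, lowerPair u v⁆ p (0, 0) = lowerPair (o * v - d * u) (o * u - d * v) p (0, 0) := by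
  obtain ⟨p₁, p₂⟩ := p
  simp only [Ring.lie_def, Matrix.sub_apply, Matrix.mul_apply, Fintype.sum_prod_type,
    Fin.sum_univ_two, lowerPair, Matrix.add_apply, Matrix.smul_apply, kronecker_apply]
  fin_cases p₁ <;> fin_cases p₂ <;> simp [hop, sigmaMinus, Matrix.one_apply] <;> ring

theorem hop_lie_lie (d o u v u' v' : ℂ) :
    ⁅⁅hop d o, lowerPair u v⁆, lowerPair u' v'⁆ =
      (2 * (d * (u * v' + v * u') - o * (u * u' + v * v'))) • sigmaMinus ⊗ₖ sigmaMinus := by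
  ext ⟨p₁, p₂⟩ ⟨q₁, q₂⟩
  simp only [Ring.lie_def, Matrix.sub_apply, Matrix.mul_apply, Fintype.sum_prod_type,
    Fin.sum_univ_two, lowerPair, Matrix.add_apply, Matrix.smul_apply, kronecker_apply]
  fin_cases p₁ <;> fin_cases p₂ <;> fin_cases q₁ <;> fin_cases q₂ <;>
    simp [hop, sigmaMinus, Matrix.one_apply] <;> ring

theorem legs_sigmaMinus_sigmaMinus {r s : Fin N} (hrs : r ≠ s) :
    legs r s (sigmaMinus ⊗ₖ sigmaMinus) = leg r sigmaMinus * leg s sigmaMinus := by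
  have h := mul_kronecker_mul sigmaMinus (1 : Matrix (Fin 2) (Fin 2) ℂ)
    (1 : Matrix (Fin 2) (Fin 2) ℂ) sigmaMinus
  rw [Matrix.mul_one, Matrix.one_mul] at h
  rw [h, legs_mul hrs, ← leg_eq_legs_left hrs, ← leg_eq_legs_right hrs]

theorem leg_sigmaMinus_mul_self (r : Fin N) : leg r sigmaMinus * leg r sigmaMinus = 0 := by
  rw [← leg_mul]
  have : sigmaMinus * sigmaMinus = 0 := by
    ext i j; fin_cases i <;> fin_cases j <;> simp [sigmaMinus]
  rw [this]
  ext σ τ; simp [leg]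

theorem leg_kappa_lie_lower (c : Chain) (Δ x : ℂ) (r : Fin N) (a : Fin N → ℂ) :
    ⁅leg r (kappa c Δ x), lower N a⁆ = (2 * Δ * rho c x * a r) • leg r sigmaMinus := by
  have h₁ : sigmaCheck * sigmaMinus = sigmaMinus := by
    ext i j; fin_cases i <;> fin_cases j <;> simp [sigmaMinus, sigmaCheck]
  have h₂ : sigmaMinus * sigmaCheck = 0 := by
    ext i j; fin_cases i <;> fin_cases j <;> simp [sigmaMinus, sigmaCheck]
  have h₃ : leg r (0 : Matrix (Fin 2) (Fin 2) ℂ) = 0 := by ext σ τ; simp [leg]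
  rw [lower_apply, ring_lie_sum, Finset.sum_eq_single r]
  · rw [kappa, leg_smul, ring_lie_smul, ring_smul_lie, Ring.lie_def, ← leg_mul, ← leg_mul, h₁,
      h₂, h₃,
      sub_zero, smul_smul, rho, mul_comm]
  · intro s _ hs
    rw [ring_lie_smul, (leg_commute_leg hs.symm _ _).lie_eq, smul_zero]
  · simp

theorem aOp_mulVec_Omega (c : Chain) (Δ : ℂ) (r : Fin N) (t : Fin N → ℂ) :
    (aOp c Δ r t).mulVec (Omega N) = 0 := by
  rw [aOp, Matrix.add_mulVec, Matrix.neg_mulVec, Matrix.sum_mulVec, Finset.sum_eq_zero, add_zero,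
    neg_eq_zero]
  · ext σ
    rw [mulVec_Omega]
    have h : ∀ i, sigmaCheck i 0 = 0 := by intro i; fin_cases i <;> simp [sigmaCheck]
    simp [leg, kappa, h]
  · intro s _
    rw [Theta_eq_hop]
    exact legs_mulVec_Omega_eq_zero (hop_apply_zero _ _)

theorem aOp_lie_lower (c : Chain) (Δ : ℂ) (r : Fin N) (t a : Fin N → ℂ) :
    ⁅aOp c Δ r t, lower N a⁆ = -((2 * Δ * rho c (t r) * a r) • leg r sigmaMinus) +
      ∑ s ∈ Finset.univ.erase r, legs r s ⁅Theta c (t r) (t s), lowerPair (a r) (a s)⁆ := by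
  rw [aOp, ring_add_lie, ring_neg_lie, leg_kappa_lie_lower, ring_sum_lie]
  congr 1
  refine Finset.sum_congr rfl fun s hs => ?_
  exact legs_lie_lower (Finset.ne_of_mem_erase hs).symm _ _

variable {c : Chain}

/-- The one-body identity: on the vacuum, the commutator of `a_r` with `β(x)` is a multiple of
`β(x)` plus a multiple of `σ_r^-`. The unwanted coefficient is `ψ(x, t_r)` times the part of `k`
times the logarithmic `x`-derivative of the weight that does not involve the other variables. -/
theorem aOp_lie_lower_mulVec_Omega {Δ x : ℂ} {r : Fin N} {t : Fin N → ℂ} (hx : b c x ≠ 0)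
    (hxt : ∀ s, b c (x + t s) ≠ 0 ∧ b c (x - t s) ≠ 0) (hr : OffPoles c r t) :
    ⁅aOp c Δ r t, lower N fun s => phi c x (t s)⁆.mulVec (Omega N) =
      -(rho c (t r + x) + rho c (t r - x)) •
          (lower N fun s => phi c x (t s)).mulVec (Omega N) +
        ((2 * (1 - Δ) * rho c x - ∑ s, (rho c (x + t s) + rho c (x - t s))) * psi c x (t r)) •
          (leg r sigmaMinus).mulVec (Omega N) := by
  set v : Fin N → V N := fun s => (leg s sigmaMinus).mulVec (Omega N) with hv
  have hlow : ∀ a : Fin N → ℂ, (lower N a).mulVec (Omega N) = ∑ s, a s • v s := by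
    intro a
    simp only [lower_apply, Matrix.sum_mulVec, Matrix.smul_mulVec, hv]
  have hterm : ∀ s ∈ Finset.univ.erase r,
      (legs r s ⁅Theta c (t r) (t s), lowerPair (phi c x (t r)) (phi c x (t s))⁆).mulVec (Omega N) =
        (-(rho c (x + t s) + rho c (x - t s)) * psi c x (t r)) • v r +
          (-(rho c (t r + x) + rho c (t r - x)) * phi c x (t s)) • v s := by
    intro s hs
    have hsr := Finset.ne_of_mem_erase hs
    obtain ⟨h₁, h₂⟩ := hr.2 s hsr
    have h := legs_mulVec_Omega_congr (r := r) (s := s)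
      (hop_lie_lowerPair_apply_zero (rho c (t r - t s) + rho c (t r + t s))
        (1 / b c (t r - t s) - 1 / b c (t r + t s)) (phi c x (t r)) (phi c x (t s)))
    rw [legs_lowerPair hsr.symm, ← phi_eq_sub h₂ h₁,
      add_comm (rho c _), one_body_exchange (hxt r).1 (hxt r).2 (hxt s).1 (hxt s).2 h₂ h₁,
      one_body_other (hxt r).1 (hxt r).2 (hxt s).1 (hxt s).2 h₂ h₁] at h
    rw [Theta_eq_hop, ← phi_eq_sub h₂ h₁, add_comm (rho c _), h, Matrix.add_mulVec,
      Matrix.smul_mulVec, Matrix.smul_mulVec]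
  rw [aOp_lie_lower, Matrix.add_mulVec, Matrix.neg_mulVec, Matrix.sum_mulVec,
    Finset.sum_congr rfl hterm, hlow, Finset.sum_add_distrib, ← Finset.sum_smul,
    ← Finset.add_sum_erase _ _ (Finset.mem_univ r),
    ← Finset.add_sum_erase (a := r) _ (fun s => rho c (x + t s) + rho c (x - t s))
      (Finset.mem_univ r), Matrix.smul_mulVec, ← neg_smul, ← neg_mul,
    one_body_self Δ hx hr.1 (hxt r).1 (hxt r).2, smul_add, Finset.smul_sum]
  simp only [smul_smul, ← Finset.sum_mul, Finset.sum_neg_distrib]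
  module

/-- The two-body identity: the double commutator of `a_r` with `β(x)` and `β(y)` is an exact
operator identity, and its right-hand side commutes with all lowering operators. -/
theorem aOp_lie_lie {Δ x y : ℂ} {r : Fin N} {t : Fin N → ℂ}
    (hxt : ∀ s, b c (x + t s) ≠ 0 ∧ b c (x - t s) ≠ 0)
    (hyt : ∀ s, b c (y + t s) ≠ 0 ∧ b c (y - t s) ≠ 0)
    (hxy : b c (x + y) ≠ 0 ∧ b c (x - y) ≠ 0) (hr : OffPoles c r t) :
    ⁅⁅aOp c Δ r t, lower N fun s => phi c x (t s)⁆, lower N fun s => phi c y (t s)⁆ =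
      leg r sigmaMinus *
        ((2 * (rho c (x + y) + rho c (x - y)) * psi c x (t r)) • lower N (fun s => phi c y (t s)) +
          (2 * (rho c (y + x) + rho c (y - x)) * psi c y (t r)) •
            lower N (fun s => phi c x (t s))) := by
  have h₀ : ⁅leg r sigmaMinus, lower N fun s => phi c y (t s)⁆ = 0 := by
    rw [← lower_single, (lower_commute _ _).lie_eq]
  rw [aOp_lie_lower, ring_add_lie, ring_neg_lie, ring_smul_lie, h₀, smul_zero, neg_zero,
    zero_add, ring_sum_lie]
  simp only [lower_apply, Finset.smul_sum, mul_add, Finset.mul_sum, ← Finset.sum_add_distrib]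
  refine Eq.trans ?_ (Finset.sum_erase (a := r) _ ?_)
  swap
  · simp only [mul_smul_comm, leg_sigmaMinus_mul_self, smul_zero, add_zero]
  simp only [mul_smul_comm]
  refine Finset.sum_congr rfl fun s hs => ?_
  have hsr := Finset.ne_of_mem_erase hs
  obtain ⟨h₁, h₂⟩ := hr.2 s hsr
  rw [← lower_apply, legs_lie_lower hsr.symm, Theta_eq_hop, hop_lie_lie, legs_smul,
    legs_sigmaMinus_sigmaMinus hsr.symm, ← phi_eq_sub h₂ h₁, add_comm (rho c (t r - t s)),
    two_body (hxt r).1 (hxt r).2 (hxt s).1 (hxt s).2 (hyt r).1 (hyt r).2 (hyt s).1 (hyt s).2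
      hxy.1 hxy.2 h₂ h₁]
  module

end

/-! ### The action of `a_r` on products of lowering operators -/

section

open Complex Function Matrix

section ListProd

variable {A : Type*} [Ring A] {M : ℕ}

theorem prod_ofFn_update_zero (B : Fin (M + 1) → A) (X : A) :
    (List.ofFn (update B 0 X)).prod = X * (List.ofFn fun i => B i.succ).prod := by
  simp [List.ofFn_succ]

theorem prod_ofFn_update_succ (B : Fin (M + 1) → A) (j : Fin M) (X : A) :
    (List.ofFn (update B j.succ X)).prod =
      B 0 * (List.ofFn (update (fun i => B i.succ) j X)).prod := by
  rw [List.ofFn_succ, List.prod_cons, update_of_ne (Fin.succ_ne_zero j).symm]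
  congr 3
  ext i
  exact update_comp_eq_of_injective' B (Fin.succ_injective M) j X ▸ rfl

/-- The Leibniz rule for an ordered product. -/
theorem lie_prod_ofFn (C : A) (B : Fin M → A) :
    ⁅C, (List.ofFn B).prod⁆ = ∑ j, (List.ofFn (update B j ⁅C, B j⁆)).prod := by
  induction M with
  | zero => simp [Ring.lie_def]
  | succ M ih =>
    rw [Fin.sum_univ_succ]
    simp only [prod_ofFn_update_zero, prod_ofFn_update_succ]
    rw [← Finset.mul_sum, ← ih, List.ofFn_succ, List.prod_cons]
    simp only [Ring.lie_def]
    noncomm_ring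

theorem commute_prod_ofFn {X : A} {B : Fin M → A} (h : ∀ i, Commute X (B i)) :
    Commute X (List.ofFn B).prod :=
  Commute.list_prod_right _ _ fun y hy => by
    obtain ⟨i, rfl⟩ := List.mem_ofFn.1 hy
    exact h i

theorem prod_ofFn_update_mul {X : A} {B : Fin M → A} (h : ∀ i, Commute X (B i)) (j : Fin M)
    (Y : A) : (List.ofFn (update B j (X * Y))).prod = X * (List.ofFn (update B j Y)).prod := by
  induction M with
  | zero => exact j.elim0
  | succ M ih =>
    refine Fin.cases ?_ (fun j => ?_) j
    · simp only [prod_ofFn_update_zero, mul_assoc]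
    · rw [prod_ofFn_update_succ, prod_ofFn_update_succ, ih fun i => h i.succ, ← mul_assoc,
        ← mul_assoc, (h 0).eq]

theorem prod_ofFn_update_linear [Algebra ℂ A] (B : Fin M → A) (j : Fin M) (u v : ℂ) (X Y : A) :
    (List.ofFn (update B j (u • X + v • Y))).prod =
      u • (List.ofFn (update B j X)).prod + v • (List.ofFn (update B j Y)).prod := by
  have h := MultilinearMap.map_update_add (MultilinearMap.mkPiAlgebraFin ℂ M A) B j (u • X) (v • Y)
  simpa only [MultilinearMap.map_update_smul, MultilinearMap.mkPiAlgebraFin_apply] using h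

end ListProd

/-- Moving `a` to the right through a product of commuting factors `β i` onto a vector `ω` which it
annihilates. Each single commutator contributes on `ω` a multiple of `β i` and an unwanted multiple
of `S`; each double commutator replaces one factor of a pair by `S`, with scalar `u`. As `S`
commutes with all factors, the triple commutators vanish. -/
theorem mulVec_prod_ofFn {n : Type*} [Fintype n] [DecidableEq n] {a S : Matrix n n ℂ}
    {ω : n → ℂ} (ha : a.mulVec ω = 0) {M : ℕ} (β : Fin M → Matrix n n ℂ) (A κ : Fin M → ℂ)
    (u : Fin M → Fin M → ℂ) (hu : ∀ i, u i i = 0)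
    (hβ : ∀ i j, Commute (β i) (β j)) (hS : ∀ i, Commute S (β i))
    (h₁ : ∀ i, ⁅a, β i⁆.mulVec ω = -A i • (β i).mulVec ω + κ i • S.mulVec ω)
    (h₂ : ∀ i j, i ≠ j → ⁅⁅a, β i⁆, β j⁆ = S * (u i j • β j + u j i • β i)) :
    a.mulVec ((List.ofFn β).prod.mulVec ω) =
      -(∑ i, A i) • (List.ofFn β).prod.mulVec ω +
        ∑ i, (κ i + ∑ j, u i j) • (List.ofFn (update β i S)).prod.mulVec ω := by
  induction M with
  | zero => simp [ha]
  | succ M ih =>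
    have ih' := ih (fun i => β i.succ) (fun i => A i.succ) (fun i => κ i.succ)
      (fun i j => u i.succ j.succ) (fun i => hu _) (fun i j => hβ _ _) (fun i => hS _)
      (fun i => h₁ _) (fun i j hij => h₂ _ _ fun h => hij (Fin.succ_injective M h))
    set P := (List.ofFn fun i => β i.succ).prod with hP
    have hPβ : Commute (β 0) P := commute_prod_ofFn fun i => hβ _ _
    have hPS : Commute S P := commute_prod_ofFn fun i => hS _
    have hpair : ∀ j : Fin M,
        (List.ofFn (update (fun i => β i.succ) j ⁅⁅a, β 0⁆, β j.succ⁆)).prod =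
          u 0 j.succ • (S * P) +
            u j.succ 0 • (β 0 * (List.ofFn (update (fun i => β i.succ) j S)).prod) := by
      intro j
      have e : ⁅⁅a, β 0⁆, β j.succ⁆ = u 0 j.succ • (S * β j.succ) + u j.succ 0 • (β 0 * S) := by
        rw [h₂ _ _ (Fin.succ_ne_zero j).symm, mul_add, mul_smul_comm, mul_smul_comm, (hS 0).eq]
      rw [e, prod_ofFn_update_linear, prod_ofFn_update_mul fun i => hS _,
        prod_ofFn_update_mul fun i => hβ _ _]
      congr 3
      rw [hP, update_eq_self]
    have key : a * (β 0 * P) = β 0 * (a * P) + P * ⁅a, β 0⁆ +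
        ∑ j : Fin M, (u 0 j.succ • (S * P) +
            u j.succ 0 • (β 0 * (List.ofFn (update (fun i => β i.succ) j S)).prod)) := by
      rw [← Finset.sum_congr rfl fun j _ => hpair j, ← lie_prod_ofFn]
      simp only [Ring.lie_def]
      noncomm_ring
    rw [List.ofFn_succ, List.prod_cons, Matrix.mulVec_mulVec, key]
    simp only [Fin.sum_univ_succ, prod_ofFn_update_zero, prod_ofFn_update_succ, hu, ← hP]
    simp only [Matrix.add_mulVec, Matrix.sum_mulVec, Matrix.smul_mulVec, ← Matrix.mulVec_mulVec,
      ih', h₁, Matrix.mulVec_add, Matrix.mulVec_smul, Matrix.mulVec_sum, Finset.sum_add_distrib,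
      add_smul, ← Finset.sum_smul]
    have e₁ : P.mulVec ((β 0).mulVec ω) = (β 0).mulVec (P.mulVec ω) := by
      rw [Matrix.mulVec_mulVec, Matrix.mulVec_mulVec, hPβ.eq]
    have e₂ : P.mulVec (S.mulVec ω) = S.mulVec (P.mulVec ω) := by
      rw [Matrix.mulVec_mulVec, Matrix.mulVec_mulVec, hPS.eq]
    rw [e₁, e₂]
    module

variable {N : ℕ}

/-- The vector `(∑ a₁ₛ σ_s^-) ⋯ (∑ a_{M,s} σ_s^-) Ω`, as a multilinear function of the coefficient
vectors `a₁, …, a_M`. -/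
def lowered (M N : ℕ) : MultilinearMap ℂ (fun _ : Fin M => Fin N → ℂ) (V N) :=
  LinearMap.compMultilinearMap
    ({ toFun := fun X => X.mulVec (Omega N)
       map_add' := fun X Y => Matrix.add_mulVec X Y _
       map_smul' := fun a X => Matrix.smul_mulVec a X _ } : Op N →ₗ[ℂ] V N)
    ((MultilinearMap.mkPiAlgebraFin ℂ M (Op N)).compLinearMap fun _ => lower N)

theorem lowered_apply {M : ℕ} (a : Fin M → Fin N → ℂ) :
    lowered M N a = (List.ofFn fun i => lower N (a i)).prod.mulVec (Omega N) := rfl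

theorem betaM_mulVec_Omega (c : Chain) {M : ℕ} (x : Fin M → ℂ) (t : Fin N → ℂ) :
    (betaM c x t).mulVec (Omega N) = lowered M N fun i s => phi c (x i) (t s) := by
  simp only [lowered_apply, betaM, beta_eq_lower]

/-- The action of `a_r` on `β(x_1) ⋯ β(x_M) Ω`. In the `i`-th unwanted term `β(x_i)` is replaced
with `ψ(x_i, t_r) σ_r^-`, and the remaining scalar is `k` times the logarithmic `x_i`-derivative of
the weight. -/
theorem aOp_mulVec_lowered {c : Chain} {M : ℕ} {Δ : ℂ} {r : Fin N} {x : Fin M → ℂ} {t : Fin N → ℂ}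
    (hx : ∀ i, b c (x i) ≠ 0)
    (hxt : ∀ i s, b c (x i + t s) ≠ 0 ∧ b c (x i - t s) ≠ 0)
    (hxx : ∀ i j, i ≠ j → b c (x i + x j) ≠ 0 ∧ b c (x i - x j) ≠ 0) (hr : OffPoles c r t) :
    (aOp c Δ r t).mulVec (lowered M N fun i s => phi c (x i) (t s)) =
      -(∑ i, (rho c (t r + x i) + rho c (t r - x i))) • lowered M N (fun i s => phi c (x i) (t s)) +
        ∑ i, ((2 * (1 - Δ) * rho c (x i) - ∑ s, (rho c (x i + t s) + rho c (x i - t s)) +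
            2 * ∑ j ∈ Finset.univ.erase i, (rho c (x i + x j) + rho c (x i - x j))) *
              psi c (x i) (t r)) •
          lowered M N (update (fun i s => phi c (x i) (t s)) i (Pi.single r 1)) := by
  have h := mulVec_prod_ofFn (aOp_mulVec_Omega c Δ r t) (S := leg r sigmaMinus)
    (fun i => lower N fun s => phi c (x i) (t s))
    (fun i => rho c (t r + x i) + rho c (t r - x i))
    (fun i => (2 * (1 - Δ) * rho c (x i) - ∑ s, (rho c (x i + t s) + rho c (x i - t s))) *
      psi c (x i) (t r))
    (fun i j => if j = i then 0 else
      2 * (rho c (x i + x j) + rho c (x i - x j)) * psi c (x i) (t r)) (fun i => if_pos rfl)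
    (fun i j => lower_commute _ _) (fun i => by rw [← lower_single]; exact lower_commute _ _)
    (fun i => aOp_lie_lower_mulVec_Omega (hx i) (hxt i) hr)
    (fun i j hij => by
      simp only [if_neg hij, if_neg hij.symm]
      exact aOp_lie_lie (hxt i) (hxt j) (hxx i j hij) hr)
  rw [lowered_apply, h]
  congr 1
  refine Finset.sum_congr rfl fun i _ => ?_
  congr 1
  · rw [add_mul]
    congr 1
    rw [Finset.mul_sum, Finset.sum_mul]
    refine (Eq.trans ?_ (Finset.sum_erase (a := i) Finset.univ ?_)).symm
    · exact Finset.sum_congr rfl fun j hj => (if_neg (Finset.ne_of_mem_erase hj)).symm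
    · exact if_pos rfl
  · rw [lowered_apply]
    congr 3
    ext1 j
    rcases eq_or_ne j i with rfl | hj
    · rw [update_self, update_self, lower_single]
    · rw [update_of_ne hj, update_of_ne hj]

end

/-! ### Derivatives of the integrand and the total derivative identity -/

section

open Complex Function

variable {c : Chain} {M N : ℕ}

theorem continuous_lowered : Continuous (lowered M N) := by
  have h : Continuous fun a : Fin M → Fin N → ℂ =>
      ((List.finRange M).map fun i => lower N (a i)).prod.mulVec (Omega N) := by
    refine Continuous.matrix_mulVec (continuous_list_prod _ fun i _ => ?_) continuous_const
    simp only [lower_apply]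
    fun_prop
  refine h.congr fun a => ?_
  rw [lowered_apply, List.ofFn_eq_map]

/-- `lowered` as a continuous multilinear map. -/
def loweredL (M N : ℕ) : ContinuousMultilinearMap ℂ (fun _ : Fin M => Fin N → ℂ) (V N) :=
  { lowered M N with cont := continuous_lowered }

theorem loweredL_apply (a : Fin M → Fin N → ℂ) : loweredL M N a = lowered M N a := rfl

/-- The pair `(x, t)` is regular: every argument of `b` in the weight and in the coefficients of
the lowering operators lies off `𝓛`. Then `b` does not vanish there and takes values in the slit
plane, so that the principal logarithms are holomorphic. -/
structure Regular (c : Chain) (x : Fin M → ℂ) (t : Fin N → ℂ) : Prop where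
  notMem : ∀ i, x i ∉ cutLines c
  add_notMem : ∀ i j, i ≠ j → x i + x j ∉ cutLines c
  sub_notMem : ∀ i j, i ≠ j → x i - x j ∉ cutLines c
  t_add_notMem : ∀ i r, t r + x i ∉ cutLines c
  t_sub_notMem : ∀ i r, t r - x i ∉ cutLines c

theorem Regular.add_t_notMem {x : Fin M → ℂ} {t : Fin N → ℂ} (h : Regular c x t) (i r) :
    x i + t r ∉ cutLines c := by rw [add_comm]; exact h.t_add_notMem i r

theorem Regular.sub_t_notMem {x : Fin M → ℂ} {t : Fin N → ℂ} (h : Regular c x t) (i r) :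
    x i - t r ∉ cutLines c := by rw [← neg_sub]; exact neg_notMem (h.t_sub_notMem i r)

theorem regular_shift {x₀ : Fin M → ℂ} (hx₀ : ∀ i, x₀ i ∉ cutLines c)
    (hx₀_pair : ∀ i j, i ≠ j → x₀ i + x₀ j ∉ cutLines c ∧ x₀ i - x₀ j ∉ cutLines c)
    {t : Fin N → ℂ} (ht : t ∈ tDomain c N x₀) (s : Fin M → ℝ) : Regular c (shift x₀ s) t where
  notMem i := add_ofReal_notMem (hx₀ i) _
  add_notMem i j hij := by
    have e : shift x₀ s i + shift x₀ s j = x₀ i + x₀ j + ((s i + s j : ℝ) : ℂ) := by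
      simp only [shift]; push_cast; ring
    rw [e]; exact add_ofReal_notMem (hx₀_pair i j hij).1 _
  sub_notMem i j hij := by
    have e : shift x₀ s i - shift x₀ s j = x₀ i - x₀ j + ((s i - s j : ℝ) : ℂ) := by
      simp only [shift]; push_cast; ring
    rw [e]; exact add_ofReal_notMem (hx₀_pair i j hij).2 _
  t_add_notMem i r := by
    rw [shift, ← add_assoc]; exact add_ofReal_notMem (ht r i).2 _
  t_sub_notMem i r := by
    have e : t r - shift x₀ s i = t r - x₀ i + ((-s i : ℝ) : ℂ) := by
      simp only [shift]; push_cast; ring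
    rw [e]; exact add_ofReal_notMem (ht r i).1 _

/-- The logarithm of the weight. -/
def logW (c : Chain) (k Δ : ℂ) (x : Fin M → ℂ) (t : Fin N → ℂ) : ℂ :=
  2 / k * (1 - Δ) * ∑ i, log (b c (x i)) +
    2 / k * ∑ i, ∑ j ∈ Finset.Ioi i, (log (b c (x i + x j)) + log (b c (x i - x j))) -
      1 / k * ∑ i, ∑ r, (log (b c (t r + x i)) + log (b c (t r - x i)))

theorem wcl_eq_exp {k Δ : ℂ} {x : Fin M → ℂ} {t : Fin N → ℂ} (hx : ∀ i, b c (x i) ≠ 0) :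
    wcl c k Δ x t = exp (logW c k Δ x t) := by
  have hg : ∀ i, b c (x i) * gcl c k Δ (x i) = exp (2 / k * (1 - Δ) * log (b c (x i))) := by
    intro i
    rw [gcl, bpow]
    nth_rewrite 1 [← exp_log (hx i)]
    rw [← exp_add]
    congr 1; ring
  rw [wcl, Gcl, logW, sub_eq_add_neg, exp_add, exp_add]
  congr 1
  · congr 1
    · rw [Finset.mul_sum, exp_sum]
      exact Finset.prod_congr rfl fun i _ => hg i
    · simp only [Finset.mul_sum, exp_sum, hcl, bpow, ← exp_add]
      refine Finset.prod_congr rfl fun i _ => Finset.prod_congr rfl fun j _ => ?_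
      congr 1; ring
  · rw [← neg_mul]
    simp only [Finset.mul_sum, exp_sum, Fcl, bpow, ← exp_add]
    refine Finset.prod_congr rfl fun i _ => Finset.prod_congr rfl fun j _ => ?_
    congr 1; ring

theorem integrand_eq {k Δ : ℂ} {x : Fin M → ℂ} {t : Fin N → ℂ} (hx : ∀ i, x i ∉ cutLines c) :
    integrand c k Δ x t =
      exp (logW c k Δ x t) • loweredL M N fun i s => phi c (x i) (t s) := by
  rw [integrand, wcl_eq_exp fun i => b_ne_zero (hx i), betaM_mulVec_Omega, loweredL_apply]

/-- The differential of `logW` at a regular pair, applied to the tangent vector `(dx, dt)`. -/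
def dlogW (c : Chain) (k Δ : ℂ) (x : Fin M → ℂ) (t : Fin N → ℂ) (dx : Fin M → ℂ)
    (dt : Fin N → ℂ) : ℂ :=
  2 / k * (1 - Δ) * ∑ i, rho c (x i) * dx i +
    2 / k * ∑ i, ∑ j ∈ Finset.Ioi i,
      (rho c (x i + x j) * (dx i + dx j) + rho c (x i - x j) * (dx i - dx j)) -
      1 / k * ∑ i, ∑ r, (rho c (t r + x i) * (dt r + dx i) + rho c (t r - x i) * (dt r - dx i))

theorem hasDerivAt_log_b {γ : ℂ → ℂ} {γ' z : ℂ} (hγ : HasDerivAt γ γ' z) (h : γ z ∉ cutLines c) :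
    HasDerivAt (fun z => log (b c (γ z))) (rho c (γ z) * γ') z := by
  have := ((hasDerivAt_b c (γ z)).comp z hγ).clog (b_mem_slitPlane h)
  refine this.congr_deriv ?_
  rw [rho, comp_apply]; ring

theorem hasDerivAt_logW {k Δ : ℂ} {X : ℂ → Fin M → ℂ} {T : ℂ → Fin N → ℂ} {dx : Fin M → ℂ}
    {dt : Fin N → ℂ} {z : ℂ} (hX : ∀ i, HasDerivAt (fun z => X z i) (dx i) z)
    (hT : ∀ r, HasDerivAt (fun z => T z r) (dt r) z) (h : Regular c (X z) (T z)) :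
    HasDerivAt (fun z => logW c k Δ (X z) (T z)) (dlogW c k Δ (X z) (T z) dx dt) z := by
  unfold logW dlogW
  refine HasDerivAt.sub (HasDerivAt.add ?_ ?_) ?_
  · refine HasDerivAt.const_mul _ (HasDerivAt.fun_sum fun i _ => ?_)
    exact hasDerivAt_log_b (hX i) (h.notMem i)
  · refine HasDerivAt.const_mul _ (HasDerivAt.fun_sum fun i _ => HasDerivAt.fun_sum fun j hj => ?_)
    have hij : i ≠ j := (Finset.mem_Ioi.1 hj).ne
    exact (hasDerivAt_log_b ((hX i).add (hX j)) (h.add_notMem i j hij)).add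
      (hasDerivAt_log_b ((hX i).sub (hX j)) (h.sub_notMem i j hij))
  · refine HasDerivAt.const_mul _ (HasDerivAt.fun_sum fun i _ => HasDerivAt.fun_sum fun r _ => ?_)
    exact (hasDerivAt_log_b ((hT r).add (hX i)) (h.t_add_notMem i r)).add
      (hasDerivAt_log_b ((hT r).sub (hX i)) (h.t_sub_notMem i r))

theorem dlogW_single_t (k Δ : ℂ) (x : Fin M → ℂ) (t : Fin N → ℂ) (r : Fin N) :
    dlogW c k Δ x t 0 (Pi.single r 1) =
      -(1 / k) * ∑ i, (rho c (t r + x i) + rho c (t r - x i)) := by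
  have : ∀ i, ∑ s, (rho c (t s + x i) * (Pi.single r 1 : Fin N → ℂ) s +
      rho c (t s - x i) * (Pi.single r 1 : Fin N → ℂ) s) =
        rho c (t r + x i) + rho c (t r - x i) := by
    intro i
    rw [Finset.sum_eq_single r] <;> simp +contextual
  simp [dlogW, this]

theorem dlogW_single_x (k Δ : ℂ) (x : Fin M → ℂ) (t : Fin N → ℂ) (m : Fin M) :
    dlogW c k Δ x t (Pi.single m 1) 0 =
      1 / k * (2 * (1 - Δ) * rho c (x m) - ∑ s, (rho c (x m + t s) + rho c (x m - t s)) +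
        2 * ∑ j ∈ Finset.univ.erase m, (rho c (x m + x j) + rho c (x m - x j))) := by
  have h₁ : ∑ i, rho c (x i) * (Pi.single m 1 : Fin M → ℂ) i = rho c (x m) := by
    rw [Finset.sum_eq_single m] <;> simp +contextual
  have h₂ : ∑ i, ∑ r, (rho c (t r + x i) * ((0 : Fin N → ℂ) r + (Pi.single m 1 : Fin M → ℂ) i) +
      rho c (t r - x i) * ((0 : Fin N → ℂ) r - (Pi.single m 1 : Fin M → ℂ) i)) =
        ∑ s, (rho c (x m + t s) + rho c (x m - t s)) := by
    rw [Finset.sum_eq_single m]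
    · refine Finset.sum_congr rfl fun s _ => ?_
      rw [← neg_sub (t s), rho_neg, add_comm (x m)]
      simp
    · intro i _ hi; simp [hi]
    · simp
  have h₃ : ∑ i, ∑ j ∈ Finset.Ioi i,
      (rho c (x i + x j) * ((Pi.single m 1 : Fin M → ℂ) i + (Pi.single m 1 : Fin M → ℂ) j) +
        rho c (x i - x j) * ((Pi.single m 1 : Fin M → ℂ) i - (Pi.single m 1 : Fin M → ℂ) j)) =
      ∑ j ∈ Finset.univ.erase m, (rho c (x m + x j) + rho c (x m - x j)) := by
    set f : Fin M → ℂ := fun j => rho c (x m + x j) + rho c (x m - x j) with hf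
    change _ = ∑ j ∈ Finset.univ.erase m, f j
    have e : ∀ i j, i ≠ j →
        rho c (x i + x j) * ((Pi.single m 1 : Fin M → ℂ) i + (Pi.single m 1 : Fin M → ℂ) j) +
        rho c (x i - x j) * ((Pi.single m 1 : Fin M → ℂ) i - (Pi.single m 1 : Fin M → ℂ) j) =
        (if i = m then f j else 0) + if j = m then f i else 0 := by
      intro i j hij
      simp only [Pi.single_apply, hf]
      have hn : rho c (x i - x m) = -rho c (x m - x i) := by rw [← rho_neg, neg_sub]
      by_cases hi : i = m
      · subst hi; simp [hij.symm]
      by_cases hj : j = m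
      · subst hj; simp only [hi, hn, if_false, if_true, add_comm (x i)]; ring
      · simp [hi, hj]
    rw [Finset.sum_congr rfl fun i _ => Finset.sum_congr rfl fun j hj =>
      e i j (Finset.mem_Ioi.1 hj).ne]
    simp only [Finset.sum_add_distrib, Finset.sum_ite_eq', Finset.mem_Ioi]
    have hu : Finset.univ.erase m = Finset.Ioi m ∪ Finset.Iio m := by
      ext j; simp [lt_or_lt_iff_ne, eq_comm]
    rw [hu, Finset.sum_union (Finset.disjoint_left.2 fun j h h' =>
      lt_asymm (Finset.mem_Ioi.1 h) (Finset.mem_Iio.1 h'))]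
    congr 1
    · rw [Finset.sum_eq_single m]
      · simp
      · intro i _ hi; simp [hi]
      · simp
    · rw [← Finset.sum_filter]
      congr 1
      ext j; simp
  unfold dlogW
  rw [h₁, h₂, h₃]
  ring

theorem hasDerivAt_update_apply {n : ℕ} (t : Fin n → ℂ) (r : Fin n) (s : Fin n) (z : ℂ) :
    HasDerivAt (fun z => update t r z s) ((Pi.single r 1 : Fin n → ℂ) s) z := by
  exact hasDerivAt_pi.1 (hasDerivAt_update t r z) s

theorem hasDerivAt_lowered_phi {x : Fin M → ℂ} {t : Fin N → ℂ} (h : Regular c x t) (r : Fin N) :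
    HasDerivAt (fun z => loweredL M N fun i s => phi c (x i) (update t r z s))
      (∑ i, dphi c (x i) (t r) •
        loweredL M N (update (fun i s => phi c (x i) (t s)) i (Pi.single r 1))) (t r) := by
  have hφ : HasDerivAt (fun z (i : Fin M) (s : Fin N) => phi c (x i) (update t r z s))
      (fun i => dphi c (x i) (t r) • (Pi.single r 1 : Fin N → ℂ)) (t r) := by
    refine hasDerivAt_pi.2 fun i => hasDerivAt_pi.2 fun s => ?_
    rcases eq_or_ne s r with rfl | hs
    · simpa using hasDerivAt_phi (b_ne_zero (h.add_t_notMem i s)) (b_ne_zero (h.sub_t_notMem i s))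
    · simpa [update_of_ne hs, hs] using hasDerivAt_const (t r) (phi c (x i) (t s))
  have := ((loweredL M N).hasFDerivAt _).comp_hasDerivAt (t r) hφ
  refine this.congr_deriv ?_
  rw [ContinuousMultilinearMap.linearDeriv_apply]
  simp only [update_eq_self]
  refine Finset.sum_congr rfl fun i _ => ?_
  rw [ContinuousMultilinearMap.map_update_smul]

theorem hasDerivAt_integrand {k Δ : ℂ} {x : Fin M → ℂ} {t : Fin N → ℂ} (h : Regular c x t)
    (r : Fin N) : HasDerivAt
      (fun z => exp (logW c k Δ x (update t r z)) •
        loweredL M N fun i s => phi c (x i) (update t r z s))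
      (exp (logW c k Δ x t) •
        (∑ i, dphi c (x i) (t r) •
          loweredL M N (update (fun i s => phi c (x i) (t s)) i (Pi.single r 1))) +
        (exp (logW c k Δ x t) * (-(1 / k) * ∑ i, (rho c (t r + x i) + rho c (t r - x i)))) •
          loweredL M N fun i s => phi c (x i) (t s)) (t r) := by
  have h₁ : HasDerivAt (fun z => logW c k Δ x (update t r z))
      (-(1 / k) * ∑ i, (rho c (t r + x i) + rho c (t r - x i))) (t r) := by
    have := hasDerivAt_logW (k := k) (Δ := Δ) (X := fun _ => x) (T := fun z => update t r z)
      (dx := 0) (z := t r) (fun i => hasDerivAt_const _ _)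
      (fun s => hasDerivAt_update_apply t r s (t r)) (by simpa using h)
    simpa only [update_eq_self, dlogW_single_t] using this
  have := h₁.cexp.smul (hasDerivAt_lowered_phi h r)
  simp only [update_eq_self] at this
  exact this

/-- The `i`-th component of the vector field in `x` whose divergence corrects `k ∂_{t_r}` of the
integrand: the integrand with `β(x_i;t)` replaced by `ψ(x_i, t_r) σ_r^-`. -/
def field (c : Chain) (k Δ : ℂ) (r : Fin N) (t : Fin N → ℂ) (i : Fin M) (x : Fin M → ℂ) : V N :=
  (exp (logW c k Δ x t) * psi c (x i) (t r)) •
    loweredL M N (update (fun i s => phi c (x i) (t s)) i (Pi.single r 1))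

theorem hasDerivAt_field {k Δ : ℂ} {x : Fin M → ℂ} {t : Fin N → ℂ} (h : Regular c x t)
    (r : Fin N) (i : Fin M) : HasDerivAt (fun z => field c k Δ r t i (update x i z))
      ((exp (logW c k Δ x t) * (1 / k * (2 * (1 - Δ) * rho c (x i) -
          ∑ s, (rho c (x i + t s) + rho c (x i - t s)) +
          2 * ∑ j ∈ Finset.univ.erase i, (rho c (x i + x j) + rho c (x i - x j)))) *
            psi c (x i) (t r) + exp (logW c k Δ x t) * -dphi c (x i) (t r)) •
        loweredL M N (update (fun i s => phi c (x i) (t s)) i (Pi.single r 1))) (x i) := by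
  have h₁ : HasDerivAt (fun z => logW c k Δ (update x i z) t)
      (1 / k * (2 * (1 - Δ) * rho c (x i) -
          ∑ s, (rho c (x i + t s) + rho c (x i - t s)) +
          2 * ∑ j ∈ Finset.univ.erase i, (rho c (x i + x j) + rho c (x i - x j)))) (x i) := by
    have := hasDerivAt_logW (k := k) (Δ := Δ) (X := fun z => update x i z) (T := fun _ => t)
      (dt := 0) (z := x i) (fun s => hasDerivAt_update_apply x i s (x i))
      (fun i => hasDerivAt_const _ _) (by simpa using h)
    simpa only [update_eq_self, dlogW_single_x] using this
  have h₂ := hasDerivAt_psi (b_ne_zero (h.add_t_notMem i r)) (b_ne_zero (h.sub_t_notMem i r))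
  have h₃ : ∀ z, (update (fun j s => phi c (update x i z j) (t s)) i (Pi.single r 1) :
      Fin M → Fin N → ℂ) = update (fun i s => phi c (x i) (t s)) i (Pi.single r 1) := by
    intro z
    ext1 j
    rcases eq_or_ne j i with rfl | hj
    · simp
    · simp [update_of_ne hj]
  have := (h₁.cexp.mul h₂).smul_const
    (loweredL M N (update (fun i s => phi c (x i) (t s)) i (Pi.single r 1)))
  simp only [update_eq_self] at this
  simp only [field, h₃, update_self]
  exact this

/-- `k ∂_{t_r}` of the integrand is `a_r` times the integrand up to a divergence in `x`. The terms
with `∂φ/∂t_r` and `∂ψ/∂x_i` cancel, and what remains is `aOp_mulVec_lowered`. -/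
theorem kz_total_derivative {k Δ : ℂ} (hk : k ≠ 0) {x : Fin M → ℂ} {t : Fin N → ℂ}
    (h : Regular c x t) {r : Fin N} (hr : OffPoles c r t) :
    k • deriv (fun z => integrand c k Δ x (update t r z)) (t r) +
      k • ∑ i, deriv (fun z => field c k Δ r t i (update x i z)) (x i) =
    (aOp c Δ r t).mulVec (integrand c k Δ x t) := by
  simp only [integrand_eq h.notMem]
  rw [(hasDerivAt_integrand h r).deriv]
  simp only [fun i => (hasDerivAt_field (k := k) (Δ := Δ) h r i).deriv]
  rw [Matrix.mulVec_smul, loweredL_apply, aOp_mulVec_lowered (fun i => b_ne_zero (h.notMem i))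
    (fun i s => ⟨b_ne_zero (h.add_t_notMem i s), b_ne_zero (h.sub_t_notMem i s)⟩)
    (fun i j hij => ⟨b_ne_zero (h.add_notMem i j hij), b_ne_zero (h.sub_notMem i j hij)⟩) hr]
  simp only [← loweredL_apply]
  set E := exp (logW c k Δ x t)
  set U := fun i => loweredL M N (update (fun i s => phi c (x i) (t s)) i (Pi.single r 1))
  set v := loweredL M N fun i s => phi c (x i) (t s)
  set K := fun i => 2 * (1 - Δ) * rho c (x i) - ∑ s, (rho c (x i + t s) + rho c (x i - t s)) +
          2 * ∑ j ∈ Finset.univ.erase i, (rho c (x i + x j) + rho c (x i - x j))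
  set S := ∑ i, (rho c (t r + x i) + rho c (t r - x i))
  have e₁ : k • ∑ i, (E * (1 / k * K i) * psi c (x i) (t r) + E * -dphi c (x i) (t r)) • U i =
      E • ∑ i, (K i * psi c (x i) (t r)) • U i - k • E • ∑ i, dphi c (x i) (t r) • U i := by
    simp only [Finset.smul_sum, ← Finset.sum_sub_distrib, smul_smul, ← sub_smul]
    refine Finset.sum_congr rfl fun i _ => ?_
    congr 1
    field_simp
    ring
  have e₂ : k • (E * (-(1 / k) * S)) • v = E • -S • v := by
    rw [smul_smul, smul_smul]
    congr 1
    field_simp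
  rw [smul_add, e₁, e₂, smul_add]
  abel

end

/-! ### Growth of `b` along horizontal lines -/

section

open Complex Function Set

variable {c : Chain} {M N : ℕ}

/-- The growth of `log |b(z+s)|` for real `s`, up to a bounded error. -/
def growth : Chain → ℝ → ℝ
  | .xxx => fun s => Real.log (1 + |s|)
  | .xxz => fun s => |s|

/-- The growth of `log |b'(z+s)|` for real `s`, up to an additive constant. -/
def growth' : Chain → ℝ → ℝ
  | .xxx => fun _ => 0
  | .xxz => fun s => |s|

theorem growth_nonneg (s : ℝ) : 0 ≤ growth c s := by
  cases c
  · exact Real.log_nonneg (by simp)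
  · exact abs_nonneg s

theorem growth_neg (s : ℝ) : growth c (-s) = growth c s := by
  cases c <;> simp [growth]

theorem tendsto_growth_atTop : Filter.Tendsto (growth c) Filter.atTop Filter.atTop := by
  cases c
  · exact Real.tendsto_log_atTop.comp
      (Filter.tendsto_atTop_add_const_left _ _ Filter.tendsto_abs_atTop_atTop)
  · exact Filter.tendsto_abs_atTop_atTop

/-- Integrability of the one-variable majorant, the only place where the exponent has to be less
than `1`. Its factors are `exp(α growth)` for the weight and `exp(growth' - 2 growth)` for `φ`. -/
theorem integrable_exp_growth {α : ℝ} (hα : α < 1) :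
    MeasureTheory.Integrable fun s => Real.exp ((α - 2) * growth c s + growth' c s) := by
  cases c
  · have h := integrable_one_add_norm (E := ℝ) (μ := MeasureTheory.volume) (r := 2 - α)
      (by simp; linarith)
    refine h.congr (Filter.Eventually.of_forall fun s => ?_)
    have : 0 < 1 + |s| := by positivity
    simp only [growth, growth', Real.norm_eq_abs]
    rw [Real.rpow_def_of_pos this]
    congr 1; ring
  · have h₁ : (fun s => Real.exp ((α - 2) * growth .xxz s + growth' .xxz s)) =
        fun s => Real.exp (-((1 - α) * |s|)) := by
      ext s; simp only [growth, growth']; congr 1; ring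
    rw [h₁]
    have hpos : (0 : ℝ) < 1 - α := by linarith
    rw [← MeasureTheory.integrableOn_univ, ← Iic_union_Ioi (a := (0 : ℝ))]
    refine MeasureTheory.IntegrableOn.union ?_ ?_
    · refine (integrableOn_exp_mul_Iic hpos 0).congr_fun (fun s hs => ?_) measurableSet_Iic
      simp only [abs_of_nonpos (mem_Iic.1 hs)]
      congr 1; ring
    · refine (integrableOn_exp_mul_Ioi (neg_lt_zero.2 hpos) 0).congr_fun (fun s hs => ?_)
        measurableSet_Ioi
      simp only [abs_of_pos (mem_Ioi.1 hs)]
      congr 1; ring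

theorem norm_sinh_le (w : ℂ) : ‖Complex.sinh w‖ ≤ Real.exp |w.re| := by
  have h := norm_sub_le (exp w) (exp (-w))
  have e₁ : Real.exp w.re ≤ Real.exp |w.re| := Real.exp_le_exp.2 (le_abs_self _)
  have e₂ : Real.exp (-w.re) ≤ Real.exp |w.re| := Real.exp_le_exp.2 (neg_le_abs _)
  rw [Complex.norm_exp, Complex.norm_exp, neg_re] at h
  rw [Complex.sinh, norm_div, Complex.norm_ofNat]
  linarith

theorem norm_cosh_le (w : ℂ) : ‖Complex.cosh w‖ ≤ Real.exp |w.re| := by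
  have h := norm_add_le (exp w) (exp (-w))
  have e₁ : Real.exp w.re ≤ Real.exp |w.re| := Real.exp_le_exp.2 (le_abs_self _)
  have e₂ : Real.exp (-w.re) ≤ Real.exp |w.re| := Real.exp_le_exp.2 (neg_le_abs _)
  rw [Complex.norm_exp, Complex.norm_exp, neg_re] at h
  rw [Complex.cosh, norm_div, Complex.norm_ofNat]
  linarith

theorem abs_re_add_ofReal_le {z : ℂ} {R : ℝ} (hz : ‖z‖ ≤ R) (s : ℝ) :
    |(z + s).re| ≤ R + |s| := by
  rw [add_re, ofReal_re]
  exact (abs_add_le _ _).trans (by gcongr; exact (abs_re_le_norm z).trans hz)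

theorem exists_norm_b_le {K : Set ℂ} (hK : IsCompact K) :
    ∃ C > 0, ∀ z ∈ K, ∀ s : ℝ, ‖b c (z + s)‖ ≤ C * Real.exp (growth c s) := by
  obtain ⟨R, hR, hKR⟩ := hK.isBounded.exists_pos_norm_le
  cases c
  · refine ⟨R + 1, by positivity, fun z hz s => ?_⟩
    have h₁ : (0 : ℝ) < 1 + |s| := by positivity
    rw [growth, Real.exp_log h₁]
    refine (norm_add_le z s).trans ?_
    rw [norm_real, Real.norm_eq_abs]
    nlinarith [hKR z hz, abs_nonneg s]
  · refine ⟨Real.exp R, by positivity, fun z hz s => (norm_sinh_le _).trans ?_⟩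
    rw [growth, ← Real.exp_add]
    exact Real.exp_le_exp.2 (abs_re_add_ofReal_le (hKR z hz) s)

theorem exists_norm_b'_le {K : Set ℂ} (hK : IsCompact K) :
    ∃ C > 0, ∀ z ∈ K, ∀ s : ℝ, ‖b' c (z + s)‖ ≤ C * Real.exp (growth' c s) := by
  obtain ⟨R, hR, hKR⟩ := hK.isBounded.exists_pos_norm_le
  cases c
  · exact ⟨1, one_pos, fun z _ s => by simp [b'_xxx, growth']⟩
  · refine ⟨Real.exp R, by positivity, fun z hz s => ?_⟩
    rw [b'_xxz]
    refine (norm_cosh_le _).trans ?_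
    rw [growth', ← Real.exp_add]
    exact Real.exp_le_exp.2 (abs_re_add_ofReal_le (hKR z hz) s)

/-- The lower bound for `b` along horizontal lines. For XXZ it rests on `Im sinh(u + iv) = cosh u *
sin v`. -/
theorem exists_le_norm_b {K : Set ℂ} (hK : IsCompact K) (hKL : ∀ z ∈ K, z ∉ cutLines c) :
    ∃ m > 0, ∀ z ∈ K, ∀ s : ℝ, m * Real.exp (growth c s) ≤ ‖b c (z + s)‖ := by
  obtain ⟨R, hR, hKR⟩ := hK.isBounded.exists_pos_norm_le
  obtain ⟨δ, hδ, hKδ⟩ : ∃ δ > 0, ∀ z ∈ K, δ ≤ |cutFn c z| := by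
    rcases K.eq_empty_or_nonempty with rfl | hne
    · exact ⟨1, one_pos, by simp⟩
    obtain ⟨z₀, hz₀, hmin⟩ := hK.exists_isMinOn hne (continuous_cutFn c).abs.continuousOn
    exact ⟨|cutFn c z₀|, abs_pos.2 fun h => hKL z₀ hz₀ ((mem_cutLines_iff z₀).2 h),
      fun z hz => hmin hz⟩
  cases c
  · refine ⟨(1 + (1 + R) / δ)⁻¹, by positivity, fun z hz s => ?_⟩
    have h₁ : (0 : ℝ) < 1 + |s| := by positivity
    rw [growth, Real.exp_log h₁, inv_mul_le_iff₀ (by positivity)]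
    have h₂ : δ ≤ ‖z + s‖ := by
      refine (hKδ z hz).trans ?_
      simpa [cutFn] using abs_im_le_norm (z + s)
    have h₃ : |s| ≤ ‖z + s‖ + R := by
      have := norm_sub_le (z + s) z
      rw [add_sub_cancel_left, norm_real, Real.norm_eq_abs] at this
      linarith [hKR z hz]
    have h₄ : 1 + R ≤ (1 + R) / δ * ‖z + s‖ := by
      rw [div_mul_eq_mul_div, le_div_iff₀ hδ]
      gcongr
    change 1 + |s| ≤ (1 + (1 + R) / δ) * ‖z + s‖
    linarith
  · refine ⟨δ / 2 * Real.exp (-R), by positivity, fun z hz s => ?_⟩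
    have h₁ : |s| - R ≤ |(z + s).re| := by
      have := abs_sub_abs_le_abs_sub s (-z.re)
      rw [abs_neg, sub_neg_eq_add, add_comm s] at this
      rw [add_re, ofReal_re]
      linarith [(abs_re_le_norm z).trans (hKR z hz)]
    have h₂ : Real.exp |(z + s).re| / 2 ≤ Real.cosh (z + s).re := by
      rw [← Real.cosh_abs, Real.cosh_eq]
      have := Real.exp_pos (-|(z + s).re|)
      linarith
    have h₃ : δ ≤ |Real.sin (z + s).im| := by simpa [cutFn] using hKδ z hz
    calc δ / 2 * Real.exp (-R) * Real.exp (growth .xxz s)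
        = δ * (Real.exp (|s| - R) / 2) := by
          rw [growth, sub_eq_add_neg, Real.exp_add]; ring
      _ ≤ |Real.sin (z + s).im| * Real.cosh (z + s).re := by
          have := Real.exp_le_exp.2 h₁
          gcongr
          linarith
      _ = |(b .xxz (z + s)).im| := by
          rw [b_xxz_im, abs_mul, abs_of_pos (Real.cosh_pos _), mul_comm]
      _ ≤ ‖b .xxz (z + s)‖ := abs_im_le_norm _

/-- `log |b(z+s)|` differs from `growth s` by a bounded amount, uniformly for `z` in a compact set
off `𝓛` and for real `s`. -/
theorem exists_abs_log_norm_b_sub_growth_le {K : Set ℂ} (hK : IsCompact K)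
    (hKL : ∀ z ∈ K, z ∉ cutLines c) :
    ∃ C, ∀ z ∈ K, ∀ s : ℝ, |Real.log ‖b c (z + s)‖ - growth c s| ≤ C := by
  obtain ⟨C, hC, hKC⟩ := exists_norm_b_le (c := c) hK
  obtain ⟨m, hm, hKm⟩ := exists_le_norm_b hK hKL
  refine ⟨max (Real.log C) (-Real.log m), fun z hz s => ?_⟩
  have hpos : 0 < ‖b c (z + s)‖ := norm_pos_iff.2 (b_ne_zero (add_ofReal_notMem (hKL z hz) s))
  have h₁ := Real.log_le_log hpos (hKC z hz s)
  have h₂ := Real.log_le_log (by positivity) (hKm z hz s)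
  rw [Real.log_mul (by positivity) (by positivity), Real.log_exp] at h₁ h₂
  rw [abs_le]
  constructor
  · linarith [le_max_right (Real.log C) (-Real.log m)]
  · linarith [le_max_left (Real.log C) (-Real.log m)]

/-- The real part of `a log z` is `log |z|` times the real part of `a`, up to a bounded error, as
the principal argument is bounded. -/
theorem re_mul_log_le (a z : ℂ) : (a * log z).re ≤ a.re * Real.log ‖z‖ + |a.im| * Real.pi := by
  rw [mul_re, log_re, log_im, sub_eq_add_neg]
  gcongr
  refine (neg_le_abs _).trans ?_
  rw [abs_mul]
  gcongr
  exact abs_arg_le_pi z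

end

/-! ### Bounds for the weight, the integrand and the field -/

section

open Complex Function Set

variable {c : Chain} {M N : ℕ}

theorem exists_re_mul_log_b_le (a : ℂ) {K : Set ℂ} (hK : IsCompact K)
    (hKL : ∀ z ∈ K, z ∉ cutLines c) : ∃ C, ∀ z ∈ K, ∀ s : ℝ,
      (a * log (b c (z + s))).re ≤ C + a.re * growth c s := by
  obtain ⟨C, hC⟩ := exists_abs_log_norm_b_sub_growth_le hK hKL
  refine ⟨|a.re| * C + |a.im| * Real.pi, fun z hz s => (re_mul_log_le _ _).trans ?_⟩
  have h : a.re * (Real.log ‖b c (z + s)‖ - growth c s) ≤ |a.re| * C := by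
    refine (le_abs_self _).trans ?_
    rw [abs_mul]
    gcongr
    exact hC z hz s
  linarith

section

variable {x₀ : Fin M → ℂ} (hx₀ : ∀ i, x₀ i ∉ cutLines c)
    (hx₀_pair : ∀ i j, i ≠ j → x₀ i + x₀ j ∉ cutLines c ∧ x₀ i - x₀ j ∉ cutLines c)
    {K : Set (Fin N → ℂ)} (hK : IsCompact K) (hKD : K ⊆ tDomain c N x₀)

include hx₀ in
theorem exists_self_le (a : ℂ) : ∃ C, ∀ s : Fin M → ℝ,
    (a * ∑ i, log (b c (shift x₀ s i))).re ≤ C + a.re * ∑ i, growth c (s i) := by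
  choose C hC using fun i => exists_re_mul_log_b_le (c := c) a (isCompact_singleton (x := x₀ i))
    (by rintro z rfl; exact hx₀ i)
  refine ⟨∑ i, C i, fun s => ?_⟩
  rw [Finset.mul_sum, re_sum, Finset.mul_sum, ← Finset.sum_add_distrib]
  exact Finset.sum_le_sum fun i _ => hC i _ rfl (s i)

include hx₀_pair in
/-- The factors `h` of the weight are bounded on `x₀ + ℝ^M`, since their exponent has nonpositive
real part. -/
theorem exists_pair_le {a : ℂ} (ha : a.re ≤ 0) : ∃ C, ∀ s : Fin M → ℝ,
    (a * ∑ i, ∑ j ∈ Finset.Ioi i, (log (b c (shift x₀ s i + shift x₀ s j)) +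
      log (b c (shift x₀ s i - shift x₀ s j)))).re ≤ C := by
  have hadd : ∀ i j, ∃ C, i < j → ∀ s : Fin M → ℝ,
      (a * log (b c (shift x₀ s i + shift x₀ s j))).re ≤ C := by
    intro i j
    by_cases hij : i < j
    · obtain ⟨C, hC⟩ := exists_re_mul_log_b_le (c := c) a
        (isCompact_singleton (x := x₀ i + x₀ j)) (by rintro z rfl; exact (hx₀_pair i j hij.ne).1)
      refine ⟨C, fun _ s => ?_⟩
      have h := hC _ rfl (s i + s j)
      have e : shift x₀ s i + shift x₀ s j = x₀ i + x₀ j + ((s i + s j : ℝ) : ℂ) := by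
        simp only [shift]; push_cast; ring
      rw [e]
      linarith [mul_nonpos_of_nonpos_of_nonneg ha (growth_nonneg (c := c) (s i + s j))]
    · exact ⟨0, fun h => absurd h hij⟩
  have hsub : ∀ i j, ∃ C, i < j → ∀ s : Fin M → ℝ,
      (a * log (b c (shift x₀ s i - shift x₀ s j))).re ≤ C := by
    intro i j
    by_cases hij : i < j
    · obtain ⟨C, hC⟩ := exists_re_mul_log_b_le (c := c) a
        (isCompact_singleton (x := x₀ i - x₀ j)) (by rintro z rfl; exact (hx₀_pair i j hij.ne).2)
      refine ⟨C, fun _ s => ?_⟩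
      have h := hC _ rfl (s i - s j)
      have e : shift x₀ s i - shift x₀ s j = x₀ i - x₀ j + ((s i - s j : ℝ) : ℂ) := by
        simp only [shift]; push_cast; ring
      rw [e]
      linarith [mul_nonpos_of_nonpos_of_nonneg ha (growth_nonneg (c := c) (s i - s j))]
    · exact ⟨0, fun h => absurd h hij⟩
  choose C₁ hC₁ using hadd
  choose C₂ hC₂ using hsub
  refine ⟨∑ i, ∑ j ∈ Finset.Ioi i, (C₁ i j + C₂ i j), fun s => ?_⟩
  simp only [Finset.mul_sum, re_sum, mul_add, add_re]
  refine Finset.sum_le_sum fun i _ => Finset.sum_le_sum fun j hj => ?_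
  have hij := Finset.mem_Ioi.1 hj
  exact add_le_add (hC₁ i j hij s) (hC₂ i j hij s)

include hK hKD in
theorem isCompact_image_add (r : Fin N) (i : Fin M) :
    IsCompact ((fun t : Fin N → ℂ => t r + x₀ i) '' K) ∧
      ∀ z ∈ (fun t : Fin N → ℂ => t r + x₀ i) '' K, z ∉ cutLines c := by
  refine ⟨hK.image (by fun_prop), ?_⟩
  rintro _ ⟨t, ht, rfl⟩
  exact (hKD ht r i).2

include hK hKD in
theorem isCompact_image_sub (r : Fin N) (i : Fin M) :
    IsCompact ((fun t : Fin N → ℂ => t r - x₀ i) '' K) ∧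
      ∀ z ∈ (fun t : Fin N → ℂ => t r - x₀ i) '' K, z ∉ cutLines c := by
  refine ⟨hK.image (by fun_prop), ?_⟩
  rintro _ ⟨t, ht, rfl⟩
  exact (hKD ht r i).1

theorem t_add_shift (t : Fin N → ℂ) (s : Fin M → ℝ) (r : Fin N) (i : Fin M) :
    t r + shift x₀ s i = t r + x₀ i + (s i : ℂ) := by rw [shift, add_assoc]

theorem t_sub_shift (t : Fin N → ℂ) (s : Fin M → ℝ) (r : Fin N) (i : Fin M) :
    t r - shift x₀ s i = t r - x₀ i + ((-s i : ℝ) : ℂ) := by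
  rw [shift]; push_cast; ring

include hK hKD in
theorem exists_inhomogeneity_le (a : ℂ) : ∃ C, ∀ t ∈ K, ∀ s : Fin M → ℝ,
    (a * ∑ i, ∑ r, (log (b c (t r + shift x₀ s i)) + log (b c (t r - shift x₀ s i)))).re ≤
      C + 2 * N * a.re * ∑ i, growth c (s i) := by
  choose C₁ hC₁ using fun i r => exists_re_mul_log_b_le (c := c) a
    (isCompact_image_add hK hKD r i).1 (isCompact_image_add hK hKD r i).2
  choose C₂ hC₂ using fun i r => exists_re_mul_log_b_le (c := c) a
    (isCompact_image_sub hK hKD r i).1 (isCompact_image_sub hK hKD r i).2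
  refine ⟨∑ i, ∑ r, (C₁ i r + C₂ i r), fun t ht s => ?_⟩
  rw [Finset.mul_sum, re_sum, Finset.mul_sum, ← Finset.sum_add_distrib]
  refine Finset.sum_le_sum fun i _ => ?_
  have e : 2 * N * a.re * growth c (s i) = ∑ _r : Fin N, 2 * (a.re * growth c (s i)) := by
    simp; ring
  rw [Finset.mul_sum, re_sum, e, ← Finset.sum_add_distrib]
  refine Finset.sum_le_sum fun r _ => ?_
  have h₁ := hC₁ i r _ ⟨t, ht, rfl⟩ (s i)
  have h₂ := hC₂ i r _ ⟨t, ht, rfl⟩ (-s i)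
  rw [growth_neg] at h₂
  rw [mul_add, add_re, t_add_shift, t_sub_shift]
  simp only at h₁ h₂
  linarith

/-- The exponent `α`: the weight at `x₀ + s` is bounded by a constant times `∏ i, exp (α * growth
(s i))`. The `2N` factors `F` involving `x_i` contribute `-2N/k`, and `b g` contributes `2(1-Δ)/k`.
-/
def decayExponent (k Δ : ℂ) (N : ℕ) : ℝ := 2 * ((1 - Δ - (N : ℂ)) / k).re

include hx₀ hx₀_pair hK hKD in
theorem exists_norm_exp_logW_le {k Δ : ℂ} (hk : k.re ≤ 0) : ∃ C > 0, ∀ t ∈ K, ∀ s : Fin M → ℝ,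
    ‖exp (logW c k Δ (shift x₀ s) t)‖ ≤
      C * Real.exp (decayExponent k Δ N * ∑ i, growth c (s i)) := by
  have ha : (2 / k).re ≤ 0 := by
    rw [div_re]
    simp only [re_ofNat, im_ofNat, zero_mul, zero_div, add_zero]
    exact div_nonpos_of_nonpos_of_nonneg (by linarith) (normSq_nonneg _)
  obtain ⟨C₁, hC₁⟩ := exists_self_le hx₀ (2 / k * (1 - Δ))
  obtain ⟨C₂, hC₂⟩ := exists_pair_le hx₀_pair ha
  obtain ⟨C₃, hC₃⟩ := exists_inhomogeneity_le hK hKD (-(1 / k))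
  refine ⟨Real.exp (C₁ + C₂ + C₃), Real.exp_pos _, fun t ht s => ?_⟩
  rw [Complex.norm_exp, ← Real.exp_add, Real.exp_le_exp, logW, sub_eq_add_neg, ← neg_mul, add_re,
    add_re]
  have hα : decayExponent k Δ N = (2 / k * (1 - Δ)).re + 2 * N * (-(1 / k)).re := by
    have : (2 : ℂ) * ((1 - Δ - (N : ℂ)) / k) = 2 / k * (1 - Δ) + 2 * N * (-(1 / k)) := by ring
    have h := congrArg Complex.re this
    rw [add_re, ← ofReal_ofNat, re_ofReal_mul, ← ofReal_natCast, ← ofReal_mul, re_ofReal_mul] at h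
    exact h
  rw [hα, add_mul]
  linarith [hC₁ s, hC₂ s, hC₃ t ht s]

include hK hKD in
theorem exists_norm_phi_le : ∃ C > 0, ∀ t ∈ K, ∀ (s : Fin M → ℝ) (i : Fin M),
    ‖fun r => phi c (shift x₀ s i) (t r)‖ ≤
      C * Real.exp (growth' c (s i) - 2 * growth c (s i)) := by
  have h : ∀ i r, ∃ C > 0, ∀ t ∈ K, ∀ s : Fin M → ℝ, ‖phi c (shift x₀ s i) (t r)‖ ≤
      C * Real.exp (growth' c (s i) - 2 * growth c (s i)) := by
    intro i r
    obtain ⟨m₁, hm₁, h₁⟩ := exists_le_norm_b (isCompact_image_add hK hKD r i).1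
      (isCompact_image_add hK hKD r i).2
    obtain ⟨m₂, hm₂, h₂⟩ := exists_le_norm_b (isCompact_image_sub hK hKD r i).1
      (isCompact_image_sub hK hKD r i).2
    obtain ⟨C₁, hC₁, h₃⟩ := exists_norm_b'_le (c := c) (isCompact_singleton (x := x₀ i))
    obtain ⟨C₂, hC₂, h₄⟩ := exists_norm_b_le (c := c)
      (hK.image (f := fun t : Fin N → ℂ => t r) (by fun_prop))
    refine ⟨2 * C₁ * (C₂ * Real.exp (growth c 0)) / (m₁ * m₂), by positivity, fun t ht s => ?_⟩
    have h₁' := h₁ _ ⟨t, ht, rfl⟩ (s i)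
    have h₂' := h₂ _ ⟨t, ht, rfl⟩ (-s i)
    have h₃' := h₃ _ rfl (s i)
    have h₄' := h₄ _ ⟨t, ht, rfl⟩ 0
    simp only [ofReal_zero, add_zero] at h₄'
    rw [← t_add_shift] at h₁'
    rw [← t_sub_shift, growth_neg] at h₂'
    rw [phi, norm_mul, norm_mul, norm_div, norm_mul, Complex.norm_ofNat, add_comm (shift x₀ s i),
      b_sub_comm, norm_neg]
    calc 2 * ‖b' c (shift x₀ s i)‖ *
          (‖b c (t r)‖ / (‖b c (t r + shift x₀ s i)‖ * ‖b c (t r - shift x₀ s i)‖))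
        ≤ 2 * (C₁ * Real.exp (growth' c (s i))) * ((C₂ * Real.exp (growth c 0)) /
            ((m₁ * Real.exp (growth c (s i))) * (m₂ * Real.exp (growth c (s i))))) := by
          gcongr
          exact h₃'
      _ = _ := by
          rw [Real.exp_sub, two_mul (growth c (s i)), Real.exp_add]
          field_simp
  choose C hC hb using h
  refine ⟨1 + ∑ i, ∑ r, C i r, ?_, fun t ht s i => ?_⟩
  · have : 0 ≤ ∑ i, ∑ r, C i r := Finset.sum_nonneg fun i _ =>
      Finset.sum_nonneg fun r _ => (hC i r).le
    linarith
  · have hs : 0 ≤ ∑ i, ∑ r, C i r :=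
      Finset.sum_nonneg fun i _ => Finset.sum_nonneg fun r _ => (hC i r).le
    refine (pi_norm_le_iff_of_nonneg (by positivity)).2 fun r => (hb i r t ht s).trans ?_
    gcongr
    have h₁ : C i r ≤ ∑ r, C i r :=
      Finset.single_le_sum (f := fun r => C i r) (fun r _ => (hC i r).le) (Finset.mem_univ r)
    have h₂ : ∑ r, C i r ≤ ∑ i, ∑ r, C i r :=
      Finset.single_le_sum (f := fun i => ∑ r, C i r)
        (fun i _ => Finset.sum_nonneg fun r _ => (hC i r).le) (Finset.mem_univ i)
    linarith

include hK hKD in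
theorem exists_norm_psi_le (r : Fin N) (i : Fin M) : ∃ C > 0, ∀ t ∈ K, ∀ s : Fin M → ℝ,
    ‖psi c (shift x₀ s i) (t r)‖ ≤ C * Real.exp (-growth c (s i)) := by
  obtain ⟨m₁, hm₁, h₁⟩ := exists_le_norm_b (isCompact_image_add hK hKD r i).1
    (isCompact_image_add hK hKD r i).2
  obtain ⟨m₂, hm₂, h₂⟩ := exists_le_norm_b (isCompact_image_sub hK hKD r i).1
    (isCompact_image_sub hK hKD r i).2
  refine ⟨1 / m₂ + 1 / m₁, by positivity, fun t ht s => ?_⟩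
  have h₁' := h₁ _ ⟨t, ht, rfl⟩ (s i)
  have h₂' := h₂ _ ⟨t, ht, rfl⟩ (-s i)
  rw [← t_add_shift, add_comm] at h₁'
  rw [← t_sub_shift, growth_neg, ← norm_neg, ← b_sub_comm] at h₂'
  have p₁ : 0 < ‖b c (shift x₀ s i + t r)‖ := lt_of_lt_of_le (by positivity) h₁'
  have p₂ : 0 < ‖b c (shift x₀ s i - t r)‖ := lt_of_lt_of_le (by positivity) h₂'
  rw [psi_eq_add (norm_pos_iff.1 p₁) (norm_pos_iff.1 p₂)]
  refine (norm_add_le _ _).trans ?_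
  rw [norm_div, norm_div, norm_one, add_mul, Real.exp_neg, ← one_div, div_mul_div_comm,
    div_mul_div_comm, one_mul]
  gcongr

include hx₀ hx₀_pair hK hKD in
theorem exists_norm_integrand_le {k Δ : ℂ} (hk : k.re ≤ 0) : ∃ C, ∀ t ∈ K, ∀ s : Fin M → ℝ,
    ‖integrand c k Δ (shift x₀ s) t‖ ≤
      C * ∏ i, Real.exp ((decayExponent k Δ N - 2) * growth c (s i) + growth' c (s i)) := by
  obtain ⟨C₁, hC₁, h₁⟩ := exists_norm_exp_logW_le hx₀ hx₀_pair hK hKD (Δ := Δ) hk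
  obtain ⟨C₂, hC₂, h₂⟩ := exists_norm_phi_le hK hKD
  refine ⟨C₁ * (‖loweredL M N‖ * C₂ ^ M), fun t ht s => ?_⟩
  rw [integrand_eq (x := shift x₀ s) fun i => add_ofReal_notMem (hx₀ i) _, norm_smul]
  calc _ ≤ C₁ * Real.exp (decayExponent k Δ N * ∑ i, growth c (s i)) *
        (‖loweredL M N‖ * ∏ i, (C₂ * Real.exp (growth' c (s i) - 2 * growth c (s i)))) := by
        gcongr
        · exact h₁ t ht s
        · refine ((loweredL M N).le_opNorm _).trans ?_
          gcongr with i
          exact h₂ t ht s i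
    _ = _ := by
        rw [Finset.prod_mul_distrib, Finset.prod_const, Finset.card_univ, Fintype.card_fin,
          Finset.mul_sum, Real.exp_sum]
        have e : ∀ i, Real.exp ((decayExponent k Δ N - 2) * growth c (s i) + growth' c (s i)) =
            Real.exp (decayExponent k Δ N * growth c (s i)) *
              Real.exp (growth' c (s i) - 2 * growth c (s i)) := by
          intro i; rw [← Real.exp_add]; congr 1; ring
        simp only [e, Finset.prod_mul_distrib]
        ring

include hx₀ hx₀_pair in
theorem exists_norm_field_le {k Δ : ℂ} (hk : k.re ≤ 0) {t : Fin N → ℂ} (ht : t ∈ tDomain c N x₀)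
    (r : Fin N) (i : Fin M) : ∃ C, ∀ s : Fin M → ℝ,
    ‖field c k Δ r t i (shift x₀ s)‖ ≤
      C * (Real.exp ((decayExponent k Δ N - 1) * growth c (s i)) * ∏ j ∈ Finset.univ.erase i,
        Real.exp ((decayExponent k Δ N - 2) * growth c (s j) + growth' c (s j))) := by
  have hK := isCompact_singleton (x := t)
  have hKD : {t} ⊆ tDomain c N x₀ := singleton_subset_iff.2 ht
  obtain ⟨C₁, hC₁, h₁⟩ := exists_norm_exp_logW_le hx₀ hx₀_pair hK hKD (Δ := Δ) hk
  obtain ⟨C₂, hC₂, h₂⟩ := exists_norm_phi_le hK hKD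
  obtain ⟨C₃, hC₃, h₃⟩ := exists_norm_psi_le hK hKD r i
  refine ⟨C₁ * C₃ * (‖loweredL M N‖ * C₂ ^ (Finset.univ.erase i).card), fun s => ?_⟩
  rw [field, norm_smul, norm_mul]
  calc _ ≤ C₁ * Real.exp (decayExponent k Δ N * ∑ i, growth c (s i)) *
        (C₃ * Real.exp (-growth c (s i))) *
        (‖loweredL M N‖ * ∏ j ∈ Finset.univ.erase i,
          (C₂ * Real.exp (growth' c (s j) - 2 * growth c (s j)))) := by
        gcongr
        · exact h₁ t rfl s
        · exact h₃ t rfl s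
        · refine ((loweredL M N).le_opNorm _).trans ?_
          gcongr
          rw [← Finset.mul_prod_erase _ _ (Finset.mem_univ i), update_self, Pi.norm_single,
            norm_one, one_mul]
          refine Finset.prod_le_prod (fun j _ => norm_nonneg _) fun j hj => ?_
          rw [update_of_ne (Finset.ne_of_mem_erase hj)]
          exact h₂ t rfl s j
    _ = _ := by
        have e : ∀ j, Real.exp ((decayExponent k Δ N - 2) * growth c (s j) + growth' c (s j)) =
            Real.exp (decayExponent k Δ N * growth c (s j)) *
              Real.exp (growth' c (s j) - 2 * growth c (s j)) := by
          intro i; rw [← Real.exp_add]; congr 1; ring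
        have e' : Real.exp ((decayExponent k Δ N - 1) * growth c (s i)) =
            Real.exp (decayExponent k Δ N * growth c (s i)) * Real.exp (-growth c (s i)) := by
          rw [← Real.exp_add]; congr 1; ring
        rw [Finset.prod_mul_distrib, Finset.prod_const, Finset.mul_sum, Real.exp_sum,
          ← Finset.mul_prod_erase _ _ (Finset.mem_univ i), e']
        simp only [e, Finset.prod_mul_distrib]
        ring

end

end

/-! ### Differentiability in several variables -/

section

open Complex Function Set

variable {c : Chain} {M N : ℕ}

theorem differentiable_b (c : Chain) : Differentiable ℂ (b c) := fun x =>
  (hasDerivAt_b c x).differentiableAt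

theorem differentiable_b' (c : Chain) : Differentiable ℂ (b' c) := fun x =>
  (hasDerivAt_b' c x).differentiableAt

theorem differentiableAt_log_b {E : Type*} [NormedAddCommGroup E] [NormedSpace ℂ E] {f : E → ℂ}
    {p : E} (hf : DifferentiableAt ℂ f p) (h : f p ∉ cutLines c) :
    DifferentiableAt ℂ (fun p => log (b c (f p))) p :=
  DifferentiableAt.clog ((differentiable_b c).differentiableAt.comp p hf) (b_mem_slitPlane h)

theorem differentiableAt_logW {k Δ : ℂ} {p : (Fin M → ℂ) × (Fin N → ℂ)}
    (h : Regular c p.1 p.2) :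
    DifferentiableAt ℂ (fun p : (Fin M → ℂ) × (Fin N → ℂ) => logW c k Δ p.1 p.2) p := by
  unfold logW
  refine DifferentiableAt.sub (DifferentiableAt.add ?_ ?_) ?_
  · refine DifferentiableAt.const_mul (DifferentiableAt.fun_sum fun i _ => ?_) _
    exact differentiableAt_log_b (by fun_prop) (h.notMem i)
  · refine DifferentiableAt.const_mul (DifferentiableAt.fun_sum fun i _ =>
      DifferentiableAt.fun_sum fun j hj => ?_) _
    have hij : i ≠ j := (Finset.mem_Ioi.1 hj).ne
    refine DifferentiableAt.fun_add (differentiableAt_log_b ?_ (h.add_notMem i j hij))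
      (differentiableAt_log_b ?_ (h.sub_notMem i j hij)) <;> fun_prop
  · refine DifferentiableAt.const_mul (DifferentiableAt.fun_sum fun i _ =>
      DifferentiableAt.fun_sum fun r _ => ?_) _
    refine DifferentiableAt.fun_add (differentiableAt_log_b ?_ (h.t_add_notMem i r))
      (differentiableAt_log_b ?_ (h.t_sub_notMem i r)) <;> fun_prop

theorem differentiableAt_phi {p : (Fin M → ℂ) × (Fin N → ℂ)} (h : Regular c p.1 p.2) (i : Fin M)
    (s : Fin N) :
    DifferentiableAt ℂ (fun p : (Fin M → ℂ) × (Fin N → ℂ) => phi c (p.1 i) (p.2 s)) p := by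
  have h₁ := differentiable_b c
  have h₂ := differentiable_b' c
  simp only [phi, div_eq_mul_inv]
  refine DifferentiableAt.fun_mul (by fun_prop)
    (DifferentiableAt.fun_mul (by fun_prop) (DifferentiableAt.fun_inv (by fun_prop) ?_))
  exact mul_ne_zero (b_ne_zero (h.add_t_notMem i s)) (b_ne_zero (h.sub_t_notMem i s))

theorem differentiableAt_psi {p : (Fin M → ℂ) × (Fin N → ℂ)} (h : Regular c p.1 p.2) (i : Fin M)
    (s : Fin N) :
    DifferentiableAt ℂ (fun p : (Fin M → ℂ) × (Fin N → ℂ) => psi c (p.1 i) (p.2 s)) p := by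
  have h₁ := differentiable_b c
  have h₂ := differentiable_b' c
  simp only [psi, div_eq_mul_inv]
  refine DifferentiableAt.fun_mul (by fun_prop)
    (DifferentiableAt.fun_mul (by fun_prop) (DifferentiableAt.fun_inv (by fun_prop) ?_))
  exact mul_ne_zero (b_ne_zero (h.add_t_notMem i s)) (b_ne_zero (h.sub_t_notMem i s))

theorem differentiable_loweredL : Differentiable ℂ (loweredL M N) := fun a =>
  ((loweredL M N).hasFDerivAt a).differentiableAt

theorem differentiableAt_integrand {k Δ : ℂ} {p : (Fin M → ℂ) × (Fin N → ℂ)}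
    (h : Regular c p.1 p.2) : DifferentiableAt ℂ (fun p : (Fin M → ℂ) × (Fin N → ℂ) =>
      exp (logW c k Δ p.1 p.2) • loweredL M N fun i s => phi c (p.1 i) (p.2 s)) p := by
  refine (differentiableAt_logW h).cexp.smul ?_
  refine differentiable_loweredL.differentiableAt.comp p ?_
  exact differentiableAt_pi.2 fun i => differentiableAt_pi.2 fun s => differentiableAt_phi h i s

theorem differentiableAt_field {k Δ : ℂ} {x : Fin M → ℂ} {t : Fin N → ℂ} (h : Regular c x t)
    (r : Fin N) (i : Fin M) : DifferentiableAt ℂ (field c k Δ r t i) x := by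
  have hpair : DifferentiableAt ℂ (fun x : Fin M → ℂ => (x, t)) x := by fun_prop
  unfold field
  refine DifferentiableAt.fun_smul (DifferentiableAt.fun_mul ?_ ?_) ?_
  · exact ((differentiableAt_logW (p := (x, t)) h).comp x hpair).cexp
  · exact (differentiableAt_psi (p := (x, t)) h i r).comp x hpair
  · refine differentiable_loweredL.differentiableAt.comp x (differentiableAt_pi.2 fun j => ?_)
    rcases eq_or_ne j i with rfl | hj
    · simp
    · simp only [update_of_ne hj]
      refine differentiableAt_pi.2 fun s => ?_
      have hφ := differentiableAt_phi (p := (x, t)) h j s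
      exact hφ.comp x hpair

theorem isOpen_tDomain (x₀ : Fin M → ℂ) : IsOpen (tDomain c N x₀) := by
  simp only [tDomain, ← Set.mem_compl_iff, Set.ofPred_forall, Set.ofPred_and]
  refine isOpen_iInter_of_finite fun r => isOpen_iInter_of_finite fun i => IsOpen.inter ?_ ?_
  · exact (isClosed_cutLines c).isOpen_compl.preimage (by fun_prop)
  · exact (isClosed_cutLines c).isOpen_compl.preimage (by fun_prop)

theorem hasFDerivAt_shift (x₀ : Fin M → ℂ) (s : Fin M → ℝ) :
    HasFDerivAt (shift x₀) (ContinuousLinearMap.pi fun i =>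
      Complex.ofRealCLM.comp
        (ContinuousLinearMap.proj (R := ℝ) (φ := fun _ : Fin M => ℝ) i)) s := by
  refine hasFDerivAt_pi.2 fun i => ?_
  exact ((Complex.ofRealCLM.comp
    (ContinuousLinearMap.proj (R := ℝ) (φ := fun _ : Fin M => ℝ) i)).hasFDerivAt).const_add (x₀ i)

theorem continuous_shift (x₀ : Fin M → ℂ) : Continuous (shift x₀) :=
  continuous_iff_continuousAt.2 fun s => (hasFDerivAt_shift x₀ s).continuousAt

theorem fderiv_comp_shift {E : Type*} [NormedAddCommGroup E] [NormedSpace ℂ E]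
    {x₀ : Fin M → ℂ} {s : Fin M → ℝ} {f : (Fin M → ℂ) → E}
    (hf : DifferentiableAt ℂ f (shift x₀ s)) (i : Fin M) :
    fderiv ℝ (fun s => f (shift x₀ s)) s (Pi.single i 1) =
      deriv (fun z => f (update (shift x₀ s) i z)) (shift x₀ s i) := by
  have h₁ := (hf.hasFDerivAt.restrictScalars ℝ).comp s (hasFDerivAt_shift x₀ s)
  have h₂ : HasDerivAt (fun z => f (update (shift x₀ s) i z))
      (fderiv ℂ f (shift x₀ s) (Pi.single i 1)) (shift x₀ s i) := by
    have := hf.hasFDerivAt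
    rw [← update_eq_self i (shift x₀ s)] at this
    have h₃ := this.comp_hasDerivAt (shift x₀ s i) (hasDerivAt_update (shift x₀ s) i _)
    rw [update_eq_self] at h₃
    exact h₃
  rw [h₂.deriv]
  change fderiv ℝ (f ∘ shift x₀) s (Pi.single i 1) = _
  rw [h₁.fderiv]
  simp only [ContinuousLinearMap.comp_apply, ContinuousLinearMap.coe_restrictScalars']
  congr 1
  ext j
  rcases eq_or_ne j i with rfl | hj <;> simp [*]

end

/-! ### The integral: convergence, analyticity, boundary KZ equations -/

section

open Complex Function Set MeasureTheory Metric

variable {c : Chain} {M N : ℕ} {x₀ : Fin M → ℂ}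

section

variable (hx₀ : ∀ i, x₀ i ∉ cutLines c)
  (hx₀_pair : ∀ i j, i ≠ j → x₀ i + x₀ j ∉ cutLines c ∧ x₀ i - x₀ j ∉ cutLines c)

include hx₀ in
theorem integrand_shift_eq (k Δ : ℂ) (t : Fin N → ℂ) (s : Fin M → ℝ) :
    integrand c k Δ (shift x₀ s) t = exp (logW c k Δ (shift x₀ s) t) •
      loweredL M N fun i r => phi c (shift x₀ s i) (t r) :=
  integrand_eq (x := shift x₀ s) fun i => add_ofReal_notMem (hx₀ i) _

include hx₀ hx₀_pair

theorem differentiableAt_integrand_t (k Δ : ℂ) {t : Fin N → ℂ} (ht : t ∈ tDomain c N x₀)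
    (s : Fin M → ℝ) : DifferentiableAt ℂ (fun t => integrand c k Δ (shift x₀ s) t) t := by
  simp only [integrand_shift_eq hx₀]
  have h := regular_shift hx₀ hx₀_pair ht s
  have hpair : DifferentiableAt ℂ (fun t : Fin N → ℂ => (shift x₀ s, t)) t := by fun_prop
  exact (differentiableAt_integrand (p := (shift x₀ s, t)) h).comp t hpair

theorem continuous_integrand_shift (k Δ : ℂ) {t : Fin N → ℂ} (ht : t ∈ tDomain c N x₀) :
    Continuous fun s => integrand c k Δ (shift x₀ s) t := by
  simp only [integrand_shift_eq hx₀]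
  refine continuous_iff_continuousAt.2 fun s => ?_
  have h := regular_shift hx₀ hx₀_pair ht s
  have hpair : ContinuousAt (fun s : Fin M → ℝ => (shift x₀ s, t)) s :=
    ((continuous_shift x₀).prodMk continuous_const).continuousAt
  exact (differentiableAt_integrand (p := (shift x₀ s, t)) h).continuousAt.comp
    (f := fun s => (shift x₀ s, t)) hpair

variable {k Δ : ℂ} (hk : k.re ≤ 0) (hα : decayExponent k Δ N < 1)

include hk hα

theorem exists_integrable_bound {K : Set (Fin N → ℂ)} (hK : IsCompact K)
    (hKD : K ⊆ tDomain c N x₀) : ∃ g : (Fin M → ℝ) → ℝ, Integrable g ∧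
      ∀ t ∈ K, ∀ s, ‖integrand c k Δ (shift x₀ s) t‖ ≤ g s := by
  obtain ⟨C, hC⟩ := exists_norm_integrand_le hx₀ hx₀_pair hK hKD (Δ := Δ) hk
  exact ⟨_, (Integrable.fintype_prod (f := fun _ s =>
    Real.exp ((decayExponent k Δ N - 2) * growth c s + growth' c s)) fun _ =>
      integrable_exp_growth hα).const_mul C, hC⟩

theorem integrable_integrand {t : Fin N → ℂ} (ht : t ∈ tDomain c N x₀) :
    Integrable fun s => integrand c k Δ (shift x₀ s) t := by
  obtain ⟨g, hg, hb⟩ := exists_integrable_bound hx₀ hx₀_pair hk hα (isCompact_singleton (x := t))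
    (singleton_subset_iff.2 ht)
  exact hg.mono' (continuous_integrand_shift hx₀ hx₀_pair k Δ ht).aestronglyMeasurable
    (Filter.Eventually.of_forall (hb t rfl))

theorem continuousOn_fcl : ContinuousOn (fcl c k Δ x₀) (tDomain c N x₀) := by
  intro t ht
  refine ContinuousAt.continuousWithinAt ?_
  obtain ⟨K, hK, htK, hKD⟩ := exists_compact_subset (isOpen_tDomain x₀) ht
  obtain ⟨g, hg, hb⟩ := exists_integrable_bound hx₀ hx₀_pair hk hα hK hKD
  have hev : ∀ᶠ u in nhds t, u ∈ K := mem_interior_iff_mem_nhds.1 htK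
  refine continuousAt_of_dominated (bound := g) ?_ ?_ hg ?_
  · exact hev.mono fun u hu =>
      (continuous_integrand_shift hx₀ hx₀_pair k Δ (hKD hu)).aestronglyMeasurable
  · exact hev.mono fun u hu => Filter.Eventually.of_forall (hb u hu)
  · exact Filter.Eventually.of_forall fun s =>
      (differentiableAt_integrand_t hx₀ hx₀_pair k Δ ht s).continuousAt

theorem hasDerivAt_fcl_update {t : Fin N → ℂ} (ht : t ∈ tDomain c N x₀) (r : Fin N) :
    Integrable (fun s => deriv (fun z => integrand c k Δ (shift x₀ s) (update t r z)) (t r)) ∧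
      HasDerivAt (fun z => fcl c k Δ x₀ (update t r z))
        (∫ s, deriv (fun z => integrand c k Δ (shift x₀ s) (update t r z)) (t r)) (t r) := by
  obtain ⟨R, hR, hRD⟩ := nhds_basis_closedBall.mem_iff.1 ((isOpen_tDomain x₀).mem_nhds ht)
  obtain ⟨g, hg, hb⟩ := exists_integrable_bound hx₀ hx₀_pair hk hα (isCompact_closedBall t R) hRD
  have hmem : ∀ z ∈ ball (t r) (2 * (R / 2)), update t r z ∈ closedBall t R := by
    intro z hz
    rw [mul_div_cancel₀ _ (two_ne_zero' ℝ)] at hz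
    refine (dist_pi_le_iff hR.le).2 fun i => ?_
    rcases eq_or_ne i r with rfl | hi
    · rw [update_self]; exact (mem_ball.1 hz).le
    · rw [update_of_ne hi, dist_self]; exact hR.le
  refine hasDerivAt_integral_of_differentiableOn (half_pos hR) (fun z hz => ?_)
    (fun z hz s => hb _ (hmem z hz) s) (fun s z hz => ?_) hg
  · exact (continuous_integrand_shift hx₀ hx₀_pair k Δ (hRD (hmem z hz))).aestronglyMeasurable
  · exact (differentiableAt_integrand_t hx₀ hx₀_pair k Δ (hRD (hmem z hz)) s).comp z
      (hasDerivAt_update t r z).differentiableAt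

theorem analyticOnNhd_fcl : AnalyticOnNhd ℂ (fcl c k Δ x₀) (tDomain c N x₀) :=
  analyticOnNhd_of_continuousOn_of_differentiableAt_update (isOpen_tDomain x₀)
    (continuousOn_fcl hx₀ hx₀_pair hk hα) fun _ ht r =>
      (hasDerivAt_fcl_update hx₀ hx₀_pair hk hα ht r).2.differentiableAt

theorem integral_sum_deriv_field {t : Fin N → ℂ} (ht : t ∈ tDomain c N x₀) (r : Fin N)
    (hint : Integrable fun s => ∑ i,
      deriv (fun z => field c k Δ r t i (update (shift x₀ s) i z)) (shift x₀ s i)) :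
    ∫ s, ∑ i, deriv (fun z => field c k Δ r t i (update (shift x₀ s) i z)) (shift x₀ s i) = 0 := by
  have hd : ∀ i s, DifferentiableAt ℂ (field c k Δ r t i) (shift x₀ s) := fun i s =>
    differentiableAt_field (regular_shift hx₀ hx₀_pair ht s) r i
  choose C hC using fun i => exists_norm_field_le hx₀ hx₀_pair (Δ := Δ) hk ht r i
  simp only [← fun i s => fderiv_comp_shift (hd i s) i] at hint ⊢
  refine integral_sum_fderiv_eq_zero (F := fun i s => field c k Δ r t i (shift x₀ s))
    (q := fun s => Real.exp ((decayExponent k Δ N - 1) * growth c s))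
    (fun i s => ((hd i s).restrictScalars ℝ).comp s (hasFDerivAt_shift x₀ s).differentiableAt)
    hint (integrable_exp_growth (c := c) hα) ?_ (fun s => by rw [growth_neg]) hC
  exact Real.tendsto_exp_atBot.comp
    (tendsto_growth_atTop.const_mul_atTop_of_neg (by linarith))

/-- The divergence of the field is integrable because, by the total derivative identity, it is the
difference of two integrable functions. -/
theorem solvesKZ_fcl (hk₀ : k ≠ 0) : SolvesKZ c k Δ (fcl c k Δ x₀) (tDomain c N x₀) := by
  intro r t ht hr
  obtain ⟨hi, hderiv⟩ := hasDerivAt_fcl_update hx₀ hx₀_pair hk hα ht r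
  have hint := integrable_integrand hx₀ hx₀_pair hk hα ht
  set Λ : V N →L[ℂ] V N := (Matrix.mulVecLin (aOp c Δ r t)).toContinuousLinearMap
  have hΛ : Integrable fun s => k⁻¹ • Λ (integrand c k Δ (shift x₀ s) t) :=
    (Λ.integrable_comp hint).smul k⁻¹
  have key : ∀ s, ∑ i,
      deriv (fun z => field c k Δ r t i (update (shift x₀ s) i z)) (shift x₀ s i) =
      k⁻¹ • Λ (integrand c k Δ (shift x₀ s) t) -
        deriv (fun z => integrand c k Δ (shift x₀ s) (update t r z)) (t r) := by
    intro s
    have h := kz_total_derivative hk₀ (Δ := Δ) (regular_shift hx₀ hx₀_pair ht s) hr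
    rw [eq_sub_iff_add_eq', eq_inv_smul_iff₀ hk₀, smul_add]
    exact h
  have hsum : Integrable fun s => ∑ i,
      deriv (fun z => field c k Δ r t i (update (shift x₀ s) i z)) (shift x₀ s i) := by
    simp only [key]
    exact hΛ.sub hi
  have h₀ := integral_sum_deriv_field hx₀ hx₀_pair hk hα ht r hsum
  simp only [key] at h₀
  rw [integral_sub hΛ hi, integral_smul, sub_eq_zero,
    inv_smul_eq_iff₀ hk₀, Λ.integral_comp_comm hint] at h₀
  rw [partialDeriv, hderiv.deriv, ← h₀]
  rfl

end

end

end BoundaryKZ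

end

theorem theorem7p1 (c : BoundaryKZ.Chain) (M N : ℕ) (k Δ : ℂ) (hk : k ≠ 0) (hk_re : k.re ≤ 0)
    (hΔ : ((1 - Δ - (N : ℂ)) / k).re < 1 / 2)
    (x₀ : Fin M → ℂ) (hx₀ : ∀ i, x₀ i ∉ BoundaryKZ.cutLines c)
    (hx₀_pair : ∀ i j, i ≠ j →
      x₀ i + x₀ j ∉ BoundaryKZ.cutLines c ∧ x₀ i - x₀ j ∉ BoundaryKZ.cutLines c) :
    (∀ t ∈ BoundaryKZ.tDomain c N x₀, MeasureTheory.Integrable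
      (fun s : Fin M → ℝ => BoundaryKZ.integrand c k Δ (BoundaryKZ.shift x₀ s) t)) ∧
    AnalyticOnNhd ℂ (BoundaryKZ.fcl c k Δ x₀) (BoundaryKZ.tDomain c N x₀) ∧
    BoundaryKZ.SolvesKZ c k Δ (BoundaryKZ.fcl c k Δ x₀) (BoundaryKZ.tDomain c N x₀) := by
  have hα : BoundaryKZ.decayExponent k Δ N < 1 := by
    rw [BoundaryKZ.decayExponent]; linarith
  exact ⟨fun t ht => BoundaryKZ.integrable_integrand hx₀ hx₀_pair hk_re hα ht,
    BoundaryKZ.analyticOnNhd_fcl hx₀ hx₀_pair hk_re hα,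
    BoundaryKZ.solvesKZ_fcl hx₀ hx₀_pair hk_re hα hk⟩
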